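/- Let words be 32-bit and let `memequal` be the following function of the C-like language Bedrock2, which compares two byte arrays of length $n$ at addresses $x$ and $y$: memequal(x, y, n) ~> r { r = 0; while n { r = r | (load1(x) ^ load1(y)); x = x + 1; y = y + 1; n = n - 1 }; r = (r == 0) } Consider the Bedrock2 compiler to RV32IM machine code with its six phases (flattening to three-address code, use of immediate operands, dead-code elimination, register allocation, spilling, machine-code generation) and its calling convention (arguments in registers $a_0,a_1,\dots$, return address in $ra$, stack pointer in $sp$, all modified non-result registers saved by the callee). Consider the RISC-V machine semantics instrumented with a leakage trace: each step appends the address of the fetched instruction and the leakage of the executed instruction, which is its kind together with the address for a load or store, the outcome for a conditional branch, the base address for an indirect jump, the shift amount for a shift by a register, and both arguments for a division or remainder (and nothing else; values read, written or computed are not leaked). Executing an invalid instruction, jumping to an address that is not a multiple of $4$, accessing unmapped memory and fetching from non-executable memory are failures; a store makes the bytes that it writes non-executable. **Lemma (memequal is constant-time at machine level).** The compiler succeeds on `memequal` and produces an instruction list $C$, with `memequal` at offset $0$, and a number $s$ of stack words that suffices to run it. For all words $x,y,n,\mathit{pos},\mathit{stackPointer},\mathit{retAddr}$ there is a leakage trace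 $\mathit{finalK}$ such that the following holds for all byte lists $xs$, $ys$, $\mathit{stackSpace}$ and all initial machine states. Assume that - $xs$ and $ys$ have length $n$, and $\mathit{stackSpace}$ has length at least $4s$; - the memory is the disjoint union of three parts: the encoding of $C$ at address $\mathit{pos}$; the bytes $\mathit{stackSpace}$, ending just below address $\mathit{stackPointer}$; and a data part that contains the array $xs$ at address $x$ and the array $ys$ at address $y$ (the two arrays may overlap) and is otherwise arbitrary; - all addresses of the code are executable, and $\mathit{pos}$ and $\mathit{retAddr}$ are multiples of $4$; - the program counter is $\mathit{pos}$, the leakage trace is empty, $sp=\mathit{stackPointer}$, $ra=\mathit{retAddr}$, and $a_0=x$, $a_1=y$, $a_2=n$. Then the machine runs without failure to a state whose program counter is $\mathit{retAddr}$ and whose leakage trace is $\mathit{finalK}$. In particular $\mathit{finalK}$ depends only on $x$, $y$, $n$, $\mathit{pos}$, $\mathit{stackPointer}$ and $\mathit{retAddr}$, and not on $xs$, $ys$ or any other contents of the memory or of the registers. -/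

import Mathlib

/-! ## Words, bytes and memory -/

namespace RiscV

abbrev Word := BitVec 32
abbrev Byte := BitVec 8

/-- Byte-granularity partial memory: `none` marks an unmapped address. -/
abbrev Mem := Word → Option Byte

/-- Register numbers `x0`, ..., `x31`. -/
abbrev Reg := BitVec 5

def zero : Reg := 0
def ra : Reg := 1
def sp : Reg := 2

/-- Little-endian load of `k` bytes at address `a`; `none` if one of them is unmapped. -/
def loadBytes (m : Mem) (a : Word) : ℕ → Option ℕ
  | 0 => some 0
  | k + 1 => do
    let b ← m a
    let rest ← loadBytes m (a + 1) k
    return b.toNat + 256 * rest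

/-- Little-endian store of the low `k ≤ 4` bytes of `v` at address `a`; `none` if one of the
addresses is unmapped. -/
def storeBytes (m : Mem) (a : Word) (k : ℕ) (v : Word) : Option Mem :=
  if (List.range k).all (fun i => (m (a + BitVec.ofNat 32 i)).isSome) then
    some (fun b => if (b - a).toNat < k then some (v.extractLsb' (8 * (b - a).toNat) 8) else m b)
  else none

/-! ## RV32IM instructions, without the system instructions -/

inductive BranchOp
  | beq | bne | blt | bge | bltu | bgeu
  deriving DecidableEq

inductive LoadOp
  | lb | lh | lw | lbu | lhu
  deriving DecidableEq

inductive StoreOp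
  | sb | sh | sw
  deriving DecidableEq

inductive ImmOp
  | addi | slti | sltiu | xori | ori | andi | slli | srli | srai
  deriving DecidableEq

inductive AluOp
  | add | sub | sll | slt | sltu | xor | srl | sra | or | and
  | mul | mulh | mulhsu | mulhu | div | divu | rem | remu
  deriving DecidableEq

inductive Instr
  | lui (rd : Reg) (imm : BitVec 20)
  | auipc (rd : Reg) (imm : BitVec 20)
  | jal (rd : Reg) (off : ℤ)
  | jalr (rd rs1 : Reg) (off : ℤ)
  | branch (c : BranchOp) (rs1 rs2 : Reg) (off : ℤ)
  | load (o : LoadOp) (rd rs1 : Reg) (off : ℤ)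
  /-- stores register `rs2` at address `rs1 + off` -/
  | store (o : StoreOp) (rs1 rs2 : Reg) (off : ℤ)
  | opImm (o : ImmOp) (rd rs1 : Reg) (imm : ℤ)
  | op (o : AluOp) (rd rs1 rs2 : Reg)
  /-- a word that is not the encoding of one of the instructions above -/
  | invalid (w : Word)
  deriving DecidableEq

def BranchOp.funct3 : BranchOp → BitVec 3
  | .beq => 0 | .bne => 1 | .blt => 4 | .bge => 5 | .bltu => 6 | .bgeu => 7

def LoadOp.funct3 : LoadOp → BitVec 3
  | .lb => 0 | .lh => 1 | .lw => 2 | .lbu => 4 | .lhu => 5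

def StoreOp.funct3 : StoreOp → BitVec 3
  | .sb => 0 | .sh => 1 | .sw => 2

def ImmOp.funct3 : ImmOp → BitVec 3
  | .addi => 0 | .slli => 1 | .slti => 2 | .sltiu => 3 | .xori => 4
  | .srli => 5 | .srai => 5 | .ori => 6 | .andi => 7

def ImmOp.isShift : ImmOp → Bool
  | .slli => true | .srli => true | .srai => true | _ => false

def AluOp.funct3 : AluOp → BitVec 3
  | .add => 0 | .sub => 0 | .sll => 1 | .slt => 2 | .sltu => 3
  | .xor => 4 | .srl => 5 | .sra => 5 | .or => 6 | .and => 7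
  | .mul => 0 | .mulh => 1 | .mulhsu => 2 | .mulhu => 3
  | .div => 4 | .divu => 5 | .rem => 6 | .remu => 7

def AluOp.funct7 : AluOp → BitVec 7
  | .sub => 0x20 | .sra => 0x20
  | .mul => 1 | .mulh => 1 | .mulhsu => 1 | .mulhu => 1
  | .div => 1 | .divu => 1 | .rem => 1 | .remu => 1
  | _ => 0

/-- The 32-bit encoding of an instruction. -/
def encode : Instr → Word
  | .lui rd imm => imm ++ rd ++ (0x37 : BitVec 7)
  | .auipc rd imm => imm ++ rd ++ (0x17 : BitVec 7)
  | .jal rd off =>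
    let i : BitVec 21 := BitVec.ofInt 21 off
    i.extractLsb' 20 1 ++ i.extractLsb' 1 10 ++ i.extractLsb' 11 1 ++ i.extractLsb' 12 8
      ++ rd ++ (0x6F : BitVec 7)
  | .jalr rd rs1 off => BitVec.ofInt 12 off ++ rs1 ++ (0 : BitVec 3) ++ rd ++ (0x67 : BitVec 7)
  | .branch c rs1 rs2 off =>
    let i : BitVec 13 := BitVec.ofInt 13 off
    i.extractLsb' 12 1 ++ i.extractLsb' 5 6 ++ rs2 ++ rs1 ++ c.funct3
      ++ i.extractLsb' 1 4 ++ i.extractLsb' 11 1 ++ (0x63 : BitVec 7)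
  | .load o rd rs1 off => BitVec.ofInt 12 off ++ rs1 ++ o.funct3 ++ rd ++ (0x03 : BitVec 7)
  | .store o rs1 rs2 off =>
    let i : BitVec 12 := BitVec.ofInt 12 off
    i.extractLsb' 5 7 ++ rs2 ++ rs1 ++ o.funct3 ++ i.extractLsb' 0 5 ++ (0x23 : BitVec 7)
  | .opImm o rd rs1 imm =>
    let i : BitVec 12 :=
      if o = .srai then (0x20 : BitVec 7) ++ BitVec.ofInt 5 imm else BitVec.ofInt 12 imm
    i ++ rs1 ++ o.funct3 ++ rd ++ (0x13 : BitVec 7)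
  | .op o rd rs1 rs2 => o.funct7 ++ rs2 ++ rs1 ++ o.funct3 ++ rd ++ (0x33 : BitVec 7)
  | .invalid w => w

/-- `x` is representable as a signed number of `k` bits. -/
def fitsSigned (k : ℕ) (x : ℤ) : Bool := -(2 : ℤ) ^ (k - 1) ≤ x && x < (2 : ℤ) ^ (k - 1)

/-- The immediate operand of the instruction is representable in its encoding. -/
def Instr.encodable : Instr → Bool
  | .jal _ off => fitsSigned 21 off && off % 2 == 0
  | .jalr _ _ off => fitsSigned 12 off
  | .branch _ _ _ off => fitsSigned 13 off && off % 2 == 0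
  | .load _ _ _ off => fitsSigned 12 off
  | .store _ _ _ off => fitsSigned 12 off
  | .opImm o _ _ imm => if o.isShift then 0 ≤ imm && imm < 32 else fitsSigned 12 imm
  | _ => true

def decodeBranch (f3 : BitVec 3) : Option BranchOp :=
  [BranchOp.beq, .bne, .blt, .bge, .bltu, .bgeu].find? (fun o => o.funct3 == f3)

def decodeLoad (f3 : BitVec 3) : Option LoadOp :=
  [LoadOp.lb, .lh, .lw, .lbu, .lhu].find? (fun o => o.funct3 == f3)

def decodeStore (f3 : BitVec 3) : Option StoreOp :=
  [StoreOp.sb, .sh, .sw].find? (fun o => o.funct3 == f3)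

def decodeAlu (f7 : BitVec 7) (f3 : BitVec 3) : Option AluOp :=
  [AluOp.add, .sub, .sll, .slt, .sltu, .xor, .srl, .sra, .or, .and,
    .mul, .mulh, .mulhsu, .mulhu, .div, .divu, .rem, .remu].find?
      (fun o => o.funct7 == f7 && o.funct3 == f3)

def decodeImm (f7 : BitVec 7) (f3 : BitVec 3) : Option ImmOp :=
  if f3 == 1 then if f7 == 0 then some .slli else none
  else if f3 == 5 then
    if f7 == 0 then some .srli else if f7 == 0x20 then some .srai else none
  else [ImmOp.addi, .slti, .sltiu, .xori, .ori, .andi].find? (fun o => o.funct3 == f3)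

/-- Instruction decoder. -/
def decode (w : Word) : Instr :=
  let opcode := w.extractLsb' 0 7
  let rd : Reg := w.extractLsb' 7 5
  let f3 := w.extractLsb' 12 3
  let rs1 : Reg := w.extractLsb' 15 5
  let rs2 : Reg := w.extractLsb' 20 5
  let f7 := w.extractLsb' 25 7
  let immI : ℤ := (w.extractLsb' 20 12).toInt
  let immS : ℤ := (w.extractLsb' 25 7 ++ w.extractLsb' 7 5).toInt
  let immB : ℤ := (w.extractLsb' 31 1 ++ w.extractLsb' 7 1 ++ w.extractLsb' 25 6
    ++ w.extractLsb' 8 4 ++ (0 : BitVec 1)).toInt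
  let immJ : ℤ := (w.extractLsb' 31 1 ++ w.extractLsb' 12 8 ++ w.extractLsb' 20 1
    ++ w.extractLsb' 21 10 ++ (0 : BitVec 1)).toInt
  let immU : BitVec 20 := w.extractLsb' 12 20
  let result : Option Instr :=
    if opcode == 0x37 then some (.lui rd immU)
    else if opcode == 0x17 then some (.auipc rd immU)
    else if opcode == 0x6F then some (.jal rd immJ)
    else if opcode == 0x67 then if f3 == 0 then some (.jalr rd rs1 immI) else none
    else if opcode == 0x63 then (decodeBranch f3).map (fun c => .branch c rs1 rs2 immB)
    else if opcode == 0x03 then (decodeLoad f3).map (fun o => .load o rd rs1 immI)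
    else if opcode == 0x23 then (decodeStore f3).map (fun o => .store o rs1 rs2 immS)
    else if opcode == 0x13 then
      (decodeImm f7 f3).map (fun o =>
        .opImm o rd rs1 (if o.isShift then ((rs2.toNat : ℕ) : ℤ) else immI))
    else if opcode == 0x33 then (decodeAlu f7 f3).map (fun o => .op o rd rs1 rs2)
    else none
  result.getD (.invalid w)

/-! ## Leakage-instrumented machine semantics -/

/-- What one instruction leaks: its kind and, for memory accesses, the address; for conditional
branches, whether the branch is taken; for indirect jumps, the base address; for shifts by a
register, the shift amount; for divisions and remainders, both arguments. -/
inductive InstrLeakage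
  | lui | auipc | jal
  | jalr (base : Word)
  | branch (c : BranchOp) (taken : Bool)
  | load (o : LoadOp) (addr : Word)
  | store (o : StoreOp) (addr : Word)
  | opImm (o : ImmOp)
  | op (o : AluOp)
  | shift (o : AluOp) (amount : Word)
  | division (o : AluOp) (dividend divisor : Word)
  deriving DecidableEq

inductive LeakageEvent
  | fetch (addr : Word)
  | exec (l : InstrLeakage)
  deriving DecidableEq

/-- Machine state; `xaddrs` is the set of addresses from which instructions may be fetched, and
`leakage` is the leakage trace in chronological order. -/
structure Machine where
  regs : Reg → Word
  pc : Word
  mem : Mem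
  xaddrs : Word → Bool
  leakage : List LeakageEvent

/-- Register read; `x0` always reads as `0`. -/
def Machine.getReg (m : Machine) (r : Reg) : Word := if r = 0 then 0 else m.regs r

def Machine.setReg (m : Machine) (r : Reg) (v : Word) : Machine :=
  { m with regs := fun r' => if r' = r then v else m.regs r' }

def BranchOp.taken : BranchOp → Word → Word → Bool
  | .beq, a, b => a == b
  | .bne, a, b => a != b
  | .blt, a, b => a.slt b
  | .bge, a, b => !a.slt b
  | .bltu, a, b => a.ult b
  | .bgeu, a, b => !a.ult b

def LoadOp.bytes : LoadOp → ℕ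
  | .lb => 1 | .lh => 2 | .lw => 4 | .lbu => 1 | .lhu => 2

def StoreOp.bytes : StoreOp → ℕ
  | .sb => 1 | .sh => 2 | .sw => 4

def LoadOp.extend : LoadOp → ℕ → Word
  | .lb, v => (BitVec.ofNat 8 v).signExtend 32
  | .lh, v => (BitVec.ofNat 16 v).signExtend 32
  | .lw, v => BitVec.ofNat 32 v
  | .lbu, v => BitVec.ofNat 32 v
  | .lhu, v => BitVec.ofNat 32 v

def boolWord (b : Bool) : Word := if b then 1 else 0

def ImmOp.eval : ImmOp → Word → ℤ → Word
  | .addi, a, i => a + BitVec.ofInt 32 i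
  | .slti, a, i => boolWord (a.slt (BitVec.ofInt 32 i))
  | .sltiu, a, i => boolWord (a.ult (BitVec.ofInt 32 i))
  | .xori, a, i => a ^^^ BitVec.ofInt 32 i
  | .ori, a, i => a ||| BitVec.ofInt 32 i
  | .andi, a, i => a &&& BitVec.ofInt 32 i
  | .slli, a, i => a <<< i.toNat
  | .srli, a, i => a >>> i.toNat
  | .srai, a, i => a.sshiftRight i.toNat

def AluOp.eval : AluOp → Word → Word → Word
  | .add, a, b => a + b
  | .sub, a, b => a - b
  | .sll, a, b => a <<< (b.toNat % 32)
  | .slt, a, b => boolWord (a.slt b)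
  | .sltu, a, b => boolWord (a.ult b)
  | .xor, a, b => a ^^^ b
  | .srl, a, b => a >>> (b.toNat % 32)
  | .sra, a, b => a.sshiftRight (b.toNat % 32)
  | .or, a, b => a ||| b
  | .and, a, b => a &&& b
  | .mul, a, b => a * b
  | .mulh, a, b => BitVec.ofInt 32 (a.toInt * b.toInt / 2 ^ 32)
  | .mulhsu, a, b => BitVec.ofInt 32 (a.toInt * (b.toNat : ℤ) / 2 ^ 32)
  | .mulhu, a, b => BitVec.ofNat 32 (a.toNat * b.toNat / 2 ^ 32)
  | .div, a, b => if b = 0 then BitVec.allOnes 32 else a.sdiv b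
  | .divu, a, b => if b = 0 then BitVec.allOnes 32 else a / b
  | .rem, a, b => if b = 0 then a else a.srem b
  | .remu, a, b => if b = 0 then a else a % b

def leakOp : AluOp → Word → Word → InstrLeakage
  | .sll, _, b => .shift .sll b
  | .srl, _, b => .shift .srl b
  | .sra, _, b => .shift .sra b
  | .div, a, b => .division .div a b
  | .divu, a, b => .division .divu a b
  | .rem, a, b => .division .rem a b
  | .remu, a, b => .division .remu a b
  | o, _, _ => .op o

/-- The leakage of an instruction that is about to execute. -/
def leakageOf (m : Machine) : Instr → Option InstrLeakage
  | .lui _ _ => some .lui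
  | .auipc _ _ => some .auipc
  | .jal _ _ => some .jal
  | .jalr _ rs1 _ => some (.jalr (m.getReg rs1))
  | .branch c rs1 rs2 _ => some (.branch c (c.taken (m.getReg rs1) (m.getReg rs2)))
  | .load o _ rs1 off => some (.load o (m.getReg rs1 + BitVec.ofInt 32 off))
  | .store o rs1 _ off => some (.store o (m.getReg rs1 + BitVec.ofInt 32 off))
  | .opImm o _ _ _ => some (.opImm o)
  | .op o _ rs1 rs2 => some (leakOp o (m.getReg rs1) (m.getReg rs2))
  | .invalid _ => none

def Machine.next (m : Machine) : Machine := { m with pc := m.pc + 4 }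

/-- Jumps to a misaligned address raise an exception, which counts as failure here. -/
def Machine.jump (m : Machine) (a : Word) : Option Machine :=
  if a.toNat % 4 = 0 then some { m with pc := a } else none

/-- Effect of an instruction on the state (not on the leakage trace). `none` is failure: an invalid
instruction, a misaligned jump, or an access to unmapped memory. A store makes the bytes that it
writes non-executable. -/
def execute (m : Machine) : Instr → Option Machine
  | .lui rd imm => some (m.setReg rd (imm ++ (0 : BitVec 12))).next
  | .auipc rd imm => some (m.setReg rd (m.pc + (imm ++ (0 : BitVec 12)))).next
  | .jal rd off => (m.setReg rd (m.pc + 4)).jump (m.pc + BitVec.ofInt 32 off)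
  | .jalr rd rs1 off =>
    (m.setReg rd (m.pc + 4)).jump ((m.getReg rs1 + BitVec.ofInt 32 off) &&& ~~~(1 : Word))
  | .branch c rs1 rs2 off =>
    if c.taken (m.getReg rs1) (m.getReg rs2) then m.jump (m.pc + BitVec.ofInt 32 off)
    else some m.next
  | .load o rd rs1 off => do
    let v ← loadBytes m.mem (m.getReg rs1 + BitVec.ofInt 32 off) o.bytes
    return (m.setReg rd (o.extend v)).next
  | .store o rs1 rs2 off => do
    let a := m.getReg rs1 + BitVec.ofInt 32 off
    let mem' ← storeBytes m.mem a o.bytes (m.getReg rs2)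
    return { m with
      mem := mem',
      xaddrs := fun b => if (b - a).toNat < o.bytes then false else m.xaddrs b }.next
  | .opImm o rd rs1 imm => some (m.setReg rd (o.eval (m.getReg rs1) imm)).next
  | .op o rd rs1 rs2 => some (m.setReg rd (o.eval (m.getReg rs1) (m.getReg rs2))).next
  | .invalid _ => none

/-- Fetch a 32-bit instruction word from executable memory. -/
def fetch (m : Machine) : Option Word :=
  if (List.range 4).all (fun i => m.xaddrs (m.pc + BitVec.ofNat 32 i)) then
    (loadBytes m.mem m.pc 4).map (BitVec.ofNat 32)
  else none

/-- One machine step: the address of the fetched instruction is leaked, then the leakage of the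
instruction itself. -/
def step (m : Machine) : Option Machine := do
  let w ← fetch m
  let l ← leakageOf m (decode w)
  execute { m with leakage := m.leakage ++ [.fetch m.pc, .exec l] } (decode w)

/-- `RunsTo m Q`: from `m`, the machine reaches without failure a state that satisfies `Q`. -/
inductive RunsTo : Machine → (Machine → Prop) → Prop
  | done {m : Machine} {Q : Machine → Prop} : Q m → RunsTo m Q
  | step {m m' : Machine} {Q : Machine → Prop} : step m = some m' → RunsTo m' Q → RunsTo m Q

/-! ## Separation-logic assertions on memory -/

/-- Separating conjunction. -/
def sep (P Q : Mem → Prop) (m : Mem) : Prop :=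
  ∃ m₁ m₂ : Mem, (∀ a, m₁ a = none ∨ m₂ a = none) ∧ (∀ a, m a = (m₁ a <|> m₂ a)) ∧ P m₁ ∧ Q m₂

/-- The memory consists exactly of the byte array `bs` at address `a`. -/
def bytesAt (a : Word) (bs : List Byte) (m : Mem) : Prop :=
  bs.length ≤ 2 ^ 32 ∧ ∀ b, m b = bs[(b - a).toNat]?

def wordBytes (w : Word) : List Byte :=
  [w.extractLsb' 0 8, w.extractLsb' 8 8, w.extractLsb' 16 8, w.extractLsb' 24 8]

/-- The memory consists exactly of the encoded instructions at address `a`. -/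
def codeAt (a : Word) (is : List Instr) : Mem → Prop :=
  bytesAt a (is.flatMap (fun i => wordBytes (encode i)))

/-- The argument registers `a0`, `a1`, ... hold the given values. -/
def argRegsContain (regs : Reg → Word) (args : List Word) : Prop :=
  args.length ≤ 8 ∧ ∀ i v, args[i]? = some v → regs (BitVec.ofNat 5 (10 + i)) = v

end RiscV

/-! ## The source language -/

namespace Bedrock2

open RiscV

/-- Identifiers of variables, and later in the compiler also registers (`0`, ..., `31`) and stack
slots (from `32` on). -/
abbrev Var := ℕ
abbrev FunName := ℕ

inductive Size
  | one | two | four | word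
  deriving DecidableEq

inductive BinOp
  | add | sub | mul | mulhuu | divu | remu | and | or | xor | sru | slu | srs | lts | ltu | eq
  deriving DecidableEq

inductive Expr
  | literal (v : ℤ)
  | var (x : Var)
  | inlinetable (sz : Size) (table : List Byte) (index : Expr)
  | load (sz : Size) (addr : Expr)
  | op (o : BinOp) (e₁ e₂ : Expr)
  | ite (c e₁ e₂ : Expr)

inductive Cmd
  | skip
  | set (x : Var) (e : Expr)
  | unset (x : Var)
  | store (sz : Size) (addr val : Expr)
  | stackalloc (x : Var) (bytes : ℕ) (body : Cmd)
  | cond (c : Expr) (c₁ c₂ : Cmd)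
  | seq (c₁ c₂ : Cmd)
  | while (c : Expr) (body : Cmd)
  | call (binds : List Var) (f : FunName) (args : List Expr)
  /-- external call (I/O) -/
  | interact (binds : List Var) (action : ℕ) (args : List Expr)

/-- A function: argument names, result names, body. -/
structure Func (B : Type) where
  name : FunName
  args : List Var
  rets : List Var
  body : B

/-! ### The program `memequal`
```
memequal(x, y, n) ~> r {
  r = 0;
  while n { r = r | (load1(x) ^ load1(y)); x = x + 1; y = y + 1; n = n - 1 };
  r = (r == 0) }
```
-/

def memequalName : FunName := 0

def memequal : Func Cmd :=
  let x : Var := 0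
  let y : Var := 1
  let n : Var := 2
  let r : Var := 3
  { name := memequalName
    args := [x, y, n]
    rets := [r]
    body :=
      .seq (.set r (.literal 0))
      (.seq
        (.while (.var n)
          (.seq (.set r (.op .or (.var r)
            (.op .xor (.load .one (.var x)) (.load .one (.var y)))))
          (.seq (.set x (.op .add (.var x) (.literal 1)))
          (.seq (.set y (.op .add (.var y) (.literal 1)))
            (.set n (.op .sub (.var n) (.literal 1)))))))
        (.set r (.op .eq (.var r) (.literal 0)))) }

/-! ## The compiler

The intermediate language is three-address code. -/

inductive Operand
  | var (x : Var)
  | const (c : ℤ)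

inductive BCond
  | bin (c : BranchOp) (x y : Var)
  | nez (x : Var)

inductive Stmt
  /-- `x = *(y + ofs)` -/
  | load (sz : Size) (x y : Var) (ofs : ℤ)
  /-- `*(x + ofs) = y` -/
  | store (sz : Size) (x y : Var) (ofs : ℤ)
  | inlinetable (sz : Size) (x : Var) (table : List Byte) (i : Var)
  | stackalloc (x : Var) (bytes : ℕ) (body : Stmt)
  | lit (x : Var) (v : ℤ)
  | op (x : Var) (o : BinOp) (y : Var) (z : Operand)
  | set (x y : Var)
  | ite (c : BCond) (s₁ s₂ : Stmt)
  /-- `s₁`, then leave the loop unless `c` holds, then `s₂` and repeat -/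
  | loop (s₁ : Stmt) (c : BCond) (s₂ : Stmt)
  | seq (s₁ s₂ : Stmt)
  | skip
  | call (binds : List Var) (f : FunName) (args : List Var)
  | interact (binds : List Var) (action : ℕ) (args : List Var)

def union (l₁ l₂ : List ℕ) : List ℕ := l₁.filter (fun x => !l₂.contains x) ++ l₂

def diff (l₁ l₂ : List ℕ) : List ℕ := l₁.filter (fun x => !l₂.contains x)

def maxVar (l : List ℕ) : ℕ := l.foldr max 0

/-! ### Phase 1: flattening

`ng` is the next unused variable name; `res`, if given, is the variable to receive the result. -/

def Expr.vars : Expr → List Var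
  | .literal _ => []
  | .var x => [x]
  | .inlinetable _ _ e => e.vars
  | .load _ e => e.vars
  | .op _ e₁ e₂ => e₁.vars ++ e₂.vars
  | .ite c e₁ e₂ => c.vars ++ e₁.vars ++ e₂.vars

def Cmd.vars : Cmd → List Var
  | .skip => []
  | .set x e => x :: e.vars
  | .unset x => [x]
  | .store _ a v => a.vars ++ v.vars
  | .stackalloc x _ body => x :: body.vars
  | .cond c c₁ c₂ => c.vars ++ c₁.vars ++ c₂.vars
  | .seq c₁ c₂ => c₁.vars ++ c₂.vars
  | .while c body => c.vars ++ body.vars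
  | .call binds _ args => binds ++ args.flatMap Expr.vars
  | .interact binds _ args => binds ++ args.flatMap Expr.vars

def resultVar (ng : Var) : Option Var → Var × Var
  | some x => (x, ng)
  | none => (ng, ng + 1)

/-- Returns the statement, the variable that holds the result, and the next unused name. -/
def flattenExpr (ng : Var) (res : Option Var) : Expr → Stmt × Var × Var
  | .literal v =>
    let (x, ng) := resultVar ng res
    (.lit x v, x, ng)
  | .var y =>
    match res with
    | some x => (.set x y, x, ng)
    | none => (.skip, y, ng)
  | .inlinetable sz t e =>
    let (s, i, ng) := flattenExpr ng none e
    let (tmp, ng) := resultVar ng none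
    match res with
    | some x => (.seq s (.seq (.inlinetable sz tmp t i) (.set x tmp)), x, ng)
    | none => (.seq s (.inlinetable sz tmp t i), tmp, ng)
  | .load sz e =>
    let (s, a, ng) := flattenExpr ng none e
    let (x, ng) := resultVar ng res
    (.seq s (.load sz x a 0), x, ng)
  | .op o e₁ e₂ =>
    let (s₁, x₁, ng) := flattenExpr ng none e₁
    let (s₂, x₂, ng) := flattenExpr ng none e₂
    let (x, ng) := resultVar ng res
    (.seq s₁ (.seq s₂ (.op x o x₁ (.var x₂))), x, ng)
  | .ite c e₁ e₂ =>
    let (s, xc, ng) := flattenExpr ng none c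
    let (x, ng) := resultVar ng res
    let (s₁, _, ng) := flattenExpr ng (some x) e₁
    let (s₂, _, ng) := flattenExpr ng (some x) e₂
    (.seq s (.ite (.nez xc) s₁ s₂), x, ng)

def flattenExprs (ng : Var) : List Expr → Stmt × List Var × Var
  | [] => (.skip, [], ng)
  | e :: es =>
    let (s, x, ng) := flattenExpr ng none e
    let (s', xs, ng) := flattenExprs ng es
    (.seq s s', x :: xs, ng)

def branchOfBinOp : BinOp → Option BranchOp
  | .lts => some .blt
  | .ltu => some .bltu
  | .eq => some .beq
  | _ => none

def flattenCond (ng : Var) (e : Expr) : Stmt × BCond × Var :=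
  let default : Stmt × BCond × Var :=
    let (s, x, ng) := flattenExpr ng none e
    (s, .nez x, ng)
  match e with
  | .op o e₁ e₂ =>
    match branchOfBinOp o with
    | some c =>
      let (s₁, x₁, ng) := flattenExpr ng none e₁
      let (s₂, x₂, ng) := flattenExpr ng none e₂
      (.seq s₁ s₂, .bin c x₁ x₂, ng)
    | none => default
  | _ => default

def flattenCmd (ng : Var) : Cmd → Stmt × Var
  | .skip => (.skip, ng)
  | .set x e =>
    let (s, _, ng) := flattenExpr ng (some x) e
    (s, ng)
  | .unset _ => (.skip, ng)
  | .store sz a v =>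
    let (s₁, x₁, ng) := flattenExpr ng none a
    let (s₂, x₂, ng) := flattenExpr ng none v
    (.seq s₁ (.seq s₂ (.store sz x₁ x₂ 0)), ng)
  | .stackalloc x n body =>
    let (s, ng) := flattenCmd ng body
    (.stackalloc x n s, ng)
  | .cond c c₁ c₂ =>
    let (s, b, ng) := flattenCond ng c
    let (s₁, ng) := flattenCmd ng c₁
    let (s₂, ng) := flattenCmd ng c₂
    (.seq s (.ite b s₁ s₂), ng)
  | .seq c₁ c₂ =>
    let (s₁, ng) := flattenCmd ng c₁
    let (s₂, ng) := flattenCmd ng c₂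
    (.seq s₁ s₂, ng)
  | .while c body =>
    let (s, b, ng) := flattenCond ng c
    let (s', ng) := flattenCmd ng body
    (.loop s b s', ng)
  | .call binds f args =>
    let (s, xs, ng) := flattenExprs ng args
    (.seq s (.call binds f xs), ng)
  | .interact binds a args =>
    let (s, xs, ng) := flattenExprs ng args
    (.seq s (.interact binds a xs), ng)

def flattenFunc (f : Func Cmd) : Func Stmt :=
  { name := f.name, args := f.args, rets := f.rets,
    body := (flattenCmd (maxVar (f.args ++ f.rets ++ f.body.vars) + 1) f.body).1 }

/-! ### Phase 2: immediates -/

/-- Rewrites `v = c; x = y op z` to use an immediate operand where the machine has one. -/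
def immediateSeq (v : Var) (c : ℤ) (x : Var) (o : BinOp) (y z : Var) : Option Stmt :=
  let commutative : Option Stmt :=
    if fitsSigned 12 c then
      if v = z then some (.op x o y (.const c))
      else if v = y then some (.op x o z (.const c))
      else none
    else none
  let right : Option Stmt :=
    if v = z && fitsSigned 12 c then some (.op x o y (.const c)) else none
  let shift : Option Stmt :=
    if v = z && (0 ≤ c && c < 32) then some (.op x o y (.const c)) else none
  match o with
  | .add => commutative
  | .and => commutative
  | .or => commutative
  | .xor => commutative
  | .sub => if v = z && fitsSigned 12 (-c) then some (.op x .add y (.const (-c))) else none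
  | .lts => right
  | .ltu => right
  | .slu => shift
  | .sru => shift
  | .srs => shift
  | _ => none

def useImmediate : Stmt → Stmt
  | .stackalloc x n s => .stackalloc x n (useImmediate s)
  | .ite c s₁ s₂ => .ite c (useImmediate s₁) (useImmediate s₂)
  | .loop s₁ c s₂ => .loop (useImmediate s₁) c (useImmediate s₂)
  | .seq s₁ s₂ =>
    match s₁, s₂ with
    | .lit v c, .op x o y (.var z) => .seq s₁ ((immediateSeq v c x o y z).getD s₂)
    | _, _ => .seq (useImmediate s₁) (useImmediate s₂)
  | s => s

/-! ### Phase 3: dead-code elimination -/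

def BCond.vars : BCond → List Var
  | .bin _ x y => union [x] [y]
  | .nez x => [x]

def Operand.vars : Operand → List Var
  | .var x => [x]
  | .const _ => []

/-- Variables live before the statement, given those live after it. -/
def live : Stmt → List Var → List Var
  | .load _ x y _, after => union [y] (diff after [x])
  | .store _ x y _, after => union (union [x] [y]) after
  | .inlinetable _ x _ i, after => union [i] (diff after [x])
  | .stackalloc x _ s, after => diff (live s after) [x]
  | .lit x _, after => diff after [x]
  | .op x _ y z, after => union (union [y] z.vars) (diff after [x])
  | .set x y, after => union [y] (diff after [x])
  | .ite c s₁ s₂, after => union c.vars (union (live s₁ after) (live s₂ after))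
  | .loop s₁ c s₂, after => live s₁ (union c.vars (union after (live s₂ [])))
  | .seq s₁ s₂, after => live s₁ (live s₂ after)
  | .skip, after => after
  | .call binds _ args, after => union args (diff after binds)
  | .interact binds _ args, after => union args (diff after binds)

/-- Variables live between `s₁` and the exit test of `loop s₁ c s₂`. -/
def liveAtTest (s₁ : Stmt) (c : BCond) (s₂ : Stmt) (after : List Var) : List Var :=
  union c.vars (union after (live s₂ (live (.loop s₁ c s₂) after)))

def deadCodeElim : Stmt → List Var → Stmt
  | .load sz x y o, after => if after.contains x then .load sz x y o else .skip
  | .inlinetable sz x t i, after => if after.contains x then .inlinetable sz x t i else .skip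
  | .lit x v, after => if after.contains x then .lit x v else .skip
  | .op x o y z, after => if after.contains x then .op x o y z else .skip
  | .set x y, after => if after.contains x then .set x y else .skip
  | .stackalloc x n s, after => .stackalloc x n (deadCodeElim s after)
  | .ite c s₁ s₂, after => .ite c (deadCodeElim s₁ after) (deadCodeElim s₂ after)
  | .loop s₁ c s₂, after =>
    .loop (deadCodeElim s₁ (liveAtTest s₁ c s₂ after)) c
      (deadCodeElim s₂ (live (.loop s₁ c s₂) after))
  | .seq s₁ s₂, after => .seq (deadCodeElim s₁ (live s₂ after)) (deadCodeElim s₂ after)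
  | s, _ => s

/-! ### Phase 4: register allocation

Every variable gets one location for its whole lifetime, an interval of program positions, and
variables with overlapping lifetimes get distinct locations. Registers `x6`-`x9` and `x18`-`x31` are
available; the argument registers `x10`-`x17` and the frame pointer `x5` are kept for the next
phases. Variables that find no register get a stack slot, numbered from `32` on. -/

structure Lifetime where
  var : Var
  lo : ℕ
  hi : ℕ

/-- Lifetime pieces of the variables of a statement that starts at position `p` and is followed by
code in which `after` are live; also returns the next position. Variables that are live at the head
of a loop live throughout the loop. -/
def lifetimes : Stmt → List Var → ℕ → List Lifetime × ℕ
  | .load _ x y _, _, p => ([⟨y, p, p⟩, ⟨x, p, p⟩], p + 1)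
  | .store _ x y _, _, p => ([⟨x, p, p⟩, ⟨y, p, p⟩], p + 1)
  | .inlinetable _ x _ i, _, p => ([⟨i, p, p⟩, ⟨x, p, p⟩], p + 1)
  | .lit x _, _, p => ([⟨x, p, p⟩], p + 1)
  | .op x _ y z, _, p => (⟨y, p, p⟩ :: z.vars.map (fun v => ⟨v, p, p⟩) ++ [⟨x, p, p⟩], p + 1)
  | .set x y, _, p => ([⟨y, p, p⟩, ⟨x, p, p⟩], p + 1)
  | .call binds _ args, _, p => ((args ++ binds).map (fun v => ⟨v, p, p⟩), p + 1)
  | .interact binds _ args, _, p => ((args ++ binds).map (fun v => ⟨v, p, p⟩), p + 1)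
  | .skip, _, p => ([], p)
  | .stackalloc x _ s, after, p =>
    let (l, q) := lifetimes s after (p + 1)
    (⟨x, p, p⟩ :: l, q)
  | .ite c s₁ s₂, after, p =>
    let (l₁, q) := lifetimes s₁ after (p + 1)
    let (l₂, q') := lifetimes s₂ after q
    (c.vars.map (fun v => ⟨v, p, p⟩) ++ l₁ ++ l₂, q')
  | .loop s₁ c s₂, after, p =>
    let head := live (.loop s₁ c s₂) after
    let (l₁, q) := lifetimes s₁ (liveAtTest s₁ c s₂ after) p
    let (l₂, q') := lifetimes s₂ head (q + 1)
    (head.map (fun v => ⟨v, p, q'⟩) ++ l₁ ++ c.vars.map (fun v => ⟨v, q, q⟩) ++ l₂, q' + 1)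
  | .seq s₁ s₂, after, p =>
    let (l₁, q) := lifetimes s₁ (live s₂ after) p
    let (l₂, q') := lifetimes s₂ after q
    (l₁ ++ l₂, q')

/-- Merge a lifetime piece into a list with one interval per variable. -/
def mergeLifetime (t : Lifetime) : List Lifetime → List Lifetime
  | [] => [t]
  | u :: us =>
    if u.var = t.var then ⟨u.var, min u.lo t.lo, max u.hi t.hi⟩ :: us
    else u :: mergeLifetime t us

/-- Insert an interval into a list sorted by starting point, after equal ones. -/
def insertLifetime (t : Lifetime) : List Lifetime → List Lifetime
  | [] => [t]
  | u :: us => if t.lo < u.lo then t :: u :: us else u :: insertLifetime t us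

def registerPool : List ℕ :=
  [6, 7, 8, 9, 18, 19, 20, 21, 22, 23, 24, 25, 26, 27, 28, 29, 30, 31]

/-- Assign to the interval the first location that no overlapping interval uses. -/
def allocate (assigned : List (Lifetime × ℕ)) (t : Lifetime) : List (Lifetime × ℕ) :=
  let free (loc : ℕ) : Bool :=
    assigned.all (fun a => a.2 != loc || a.1.hi < t.lo || t.hi < a.1.lo)
  let locs := registerPool ++ (List.range (assigned.length + 1)).map (fun i => 32 + i)
  assigned ++ [(t, (locs.find? free).getD (32 + assigned.length))]

def assignment (f : Func Stmt) : List (Lifetime × ℕ) :=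
  let (l, q) := lifetimes f.body f.rets 1
  let pieces := f.args.map (fun v => ⟨v, 0, 0⟩) ++ l ++ f.rets.map (fun v => ⟨v, q, q⟩)
  let merged := pieces.foldl (fun acc t => mergeLifetime t acc) []
  let sorted := merged.foldl (fun acc t => insertLifetime t acc) []
  sorted.foldl allocate []

def locationOf (a : List (Lifetime × ℕ)) (x : Var) : ℕ :=
  ((a.find? (fun t => t.1.var == x)).map Prod.snd).getD 0

def BCond.rename (ρ : Var → Var) : BCond → BCond
  | .bin c x y => .bin c (ρ x) (ρ y)
  | .nez x => .nez (ρ x)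

def Operand.rename (ρ : Var → Var) : Operand → Operand
  | .var x => .var (ρ x)
  | .const c => .const c

def Stmt.rename (ρ : Var → Var) : Stmt → Stmt
  | .load sz x y o => .load sz (ρ x) (ρ y) o
  | .store sz x y o => .store sz (ρ x) (ρ y) o
  | .inlinetable sz x t i => .inlinetable sz (ρ x) t (ρ i)
  | .stackalloc x n s => .stackalloc (ρ x) n (s.rename ρ)
  | .lit x v => .lit (ρ x) v
  | .op x o y z => .op (ρ x) o (ρ y) (z.rename ρ)
  | .set x y => .set (ρ x) (ρ y)
  | .ite c s₁ s₂ => .ite (c.rename ρ) (s₁.rename ρ) (s₂.rename ρ)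
  | .loop s₁ c s₂ => .loop (s₁.rename ρ) (c.rename ρ) (s₂.rename ρ)
  | .seq s₁ s₂ => .seq (s₁.rename ρ) (s₂.rename ρ)
  | .skip => .skip
  | .call binds f args => .call (binds.map ρ) f (args.map ρ)
  | .interact binds a args => .interact (binds.map ρ) a (args.map ρ)

def regAllocFunc (f : Func Stmt) : Func Stmt :=
  let ρ := locationOf (assignment f)
  { name := f.name, args := f.args.map ρ, rets := f.rets.map ρ, body := f.body.rename ρ }

/-! ### Phase 5: spilling

Variables from `32` on move to stack slots, addressed from the frame pointer. Arguments and results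
of functions move to the argument registers, which also hold the operands loaded from slots. -/

def fp : Var := 5
def a0 : Var := 10

def slotOffset (x : Var) : ℤ := 4 * ((x : ℤ) - 32)

/-- The register that holds operand number `i` (from `1` on). -/
def argReg (i : ℕ) (x : Var) : Var := if 32 ≤ x then 9 + i else x

def resReg (x : Var) : Var := if 32 ≤ x then 10 else x

def loadArg (i : ℕ) (x : Var) : Stmt :=
  if 32 ≤ x then .load .word (9 + i) fp (slotOffset x) else .skip

def saveRes (x : Var) : Stmt :=
  if 32 ≤ x then .store .word fp 10 (slotOffset x) else .skip

def setVarsToRegs : List Var → ℕ → Stmt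
  | [], _ => .skip
  | x :: xs, r =>
    .seq (if 32 ≤ x then .store .word fp r (slotOffset x) else .set x r) (setVarsToRegs xs (r + 1))

def setRegsToVars (r : ℕ) : List Var → Stmt
  | [] => .skip
  | x :: xs =>
    .seq (if 32 ≤ x then .load .word r fp (slotOffset x) else .set r x) (setRegsToVars (r + 1) xs)

def argRegs (k : ℕ) : List Var := (List.range k).map (fun i => a0 + i)

def prepareCond : BCond → Stmt
  | .bin _ x y => .seq (loadArg 1 x) (loadArg 2 y)
  | .nez x => loadArg 1 x

def spillCond : BCond → BCond
  | .bin c x y => .bin c (argReg 1 x) (argReg 2 y)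
  | .nez x => .nez (argReg 1 x)

def spillStmt : Stmt → Stmt
  | .load sz x y o =>
    .seq (loadArg 1 y) (.seq (.load sz (resReg x) (argReg 1 y) o) (saveRes x))
  | .store sz x y o =>
    .seq (loadArg 1 x) (.seq (loadArg 2 y) (.store sz (argReg 1 x) (argReg 2 y) o))
  | .inlinetable sz x t i =>
    .seq (loadArg 2 i) (.seq (.inlinetable sz (resReg x) t (argReg 2 i)) (saveRes x))
  | .stackalloc x n s => .stackalloc (resReg x) n (.seq (saveRes x) (spillStmt s))
  | .lit x v => .seq (.lit (resReg x) v) (saveRes x)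
  | .op x o y z =>
    .seq (loadArg 1 y) (match z with
      | .var w => .seq (loadArg 2 w)
          (.seq (.op (resReg x) o (argReg 1 y) (.var (argReg 2 w))) (saveRes x))
      | .const c => .seq (.op (resReg x) o (argReg 1 y) (.const c)) (saveRes x))
  | .set x y => .seq (loadArg 1 y) (.seq (.set (resReg x) (argReg 1 y)) (saveRes x))
  | .ite c s₁ s₂ => .seq (prepareCond c) (.ite (spillCond c) (spillStmt s₁) (spillStmt s₂))
  | .loop s₁ c s₂ => .loop (.seq (spillStmt s₁) (prepareCond c)) (spillCond c) (spillStmt s₂)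
  | .seq s₁ s₂ => .seq (spillStmt s₁) (spillStmt s₂)
  | .skip => .skip
  | .call binds f args =>
    .seq (setRegsToVars a0 args)
      (.seq (.call (argRegs binds.length) f (argRegs args.length)) (setVarsToRegs binds a0))
  | .interact binds a args =>
    .seq (setRegsToVars a0 args)
      (.seq (.interact (argRegs binds.length) a (argRegs args.length)) (setVarsToRegs binds a0))

/-- At most eight arguments and eight results are passed at each call. -/
def Stmt.callsFit : Stmt → Bool
  | .stackalloc _ _ s => s.callsFit
  | .ite _ s₁ s₂ => s₁.callsFit && s₂.callsFit
  | .loop s₁ _ s₂ => s₁.callsFit && s₂.callsFit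
  | .seq s₁ s₂ => s₁.callsFit && s₂.callsFit
  | .call binds _ args => binds.length ≤ 8 && args.length ≤ 8
  | .interact binds _ args => binds.length ≤ 8 && args.length ≤ 8
  | _ => true

def Stmt.vars : Stmt → List Var
  | .load _ x y _ => [x, y]
  | .store _ x y _ => [x, y]
  | .inlinetable _ x _ i => [x, i]
  | .stackalloc x _ s => x :: s.vars
  | .lit x _ => [x]
  | .op x _ y z => x :: y :: z.vars
  | .set x y => [x, y]
  | .ite c s₁ s₂ => c.vars ++ s₁.vars ++ s₂.vars
  | .loop s₁ c s₂ => s₁.vars ++ c.vars ++ s₂.vars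
  | .seq s₁ s₂ => s₁.vars ++ s₂.vars
  | .skip => []
  | .call binds _ args => binds ++ args
  | .interact binds _ args => binds ++ args

def spillFunc (f : Func Stmt) : Option (Func Stmt) :=
  if f.args.length ≤ 8 && f.rets.length ≤ 8 && f.body.callsFit then
    let slots := maxVar (f.args ++ f.rets ++ f.body.vars) - 31
    some
      { name := f.name
        args := argRegs f.args.length
        rets := argRegs f.rets.length
        body := .stackalloc fp (4 * slots)
          (.seq (setVarsToRegs f.args a0) (.seq (spillStmt f.body) (setRegsToVars a0 f.rets))) }
  else none

/-! ### Phase 6: machine-code generation -/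

def reg (x : Var) : Reg := BitVec.ofNat 5 x

def compileLoad : Size → Var → Var → ℤ → Instr
  | .one, x, y, o => .load .lbu (reg x) (reg y) o
  | .two, x, y, o => .load .lhu (reg x) (reg y) o
  | .four, x, y, o => .load .lw (reg x) (reg y) o
  | .word, x, y, o => .load .lw (reg x) (reg y) o

def compileStore : Size → Var → Var → ℤ → Instr
  | .one, x, y, o => .store .sb (reg x) (reg y) o
  | .two, x, y, o => .store .sh (reg x) (reg y) o
  | .four, x, y, o => .store .sw (reg x) (reg y) o
  | .word, x, y, o => .store .sw (reg x) (reg y) o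

def compileOpReg (x : Var) (o : BinOp) (y z : Var) : List Instr :=
  let simple (a : AluOp) : List Instr := [.op a (reg x) (reg y) (reg z)]
  match o with
  | .add => simple .add
  | .sub => simple .sub
  | .mul => simple .mul
  | .mulhuu => simple .mulhu
  | .divu => simple .divu
  | .remu => simple .remu
  | .and => simple .and
  | .or => simple .or
  | .xor => simple .xor
  | .sru => simple .srl
  | .slu => simple .sll
  | .srs => simple .sra
  | .lts => simple .slt
  | .ltu => simple .sltu
  | .eq => [.op .sub (reg x) (reg y) (reg z), .opImm .sltiu (reg x) (reg x) 1]

def compileOpImm (x : Var) (o : BinOp) (y : Var) (c : ℤ) : List Instr :=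
  let simple (a : ImmOp) : List Instr := [.opImm a (reg x) (reg y) c]
  match o with
  | .add => simple .addi
  | .and => simple .andi
  | .or => simple .ori
  | .xor => simple .xori
  | .sru => simple .srli
  | .slu => simple .slli
  | .srs => simple .srai
  | .lts => simple .slti
  | .ltu => simple .sltiu
  | _ => [.invalid 0]

def compileLit (x : Var) (v : ℤ) : List Instr :=
  if fitsSigned 12 v then [.opImm .addi (reg x) zero v]
  else
    let w : Word := BitVec.ofInt 32 v
    let lo : BitVec 12 := w.extractLsb' 0 12
    let hi : Word := w ^^^ lo.signExtend 32
    [.lui (reg x) (hi.extractLsb' 12 20), .opImm .xori (reg x) (reg x) lo.toInt]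

/-- Jump by `off` bytes if the condition does not hold. -/
def compileCondInverted : BCond → ℤ → Instr
  | .bin .beq x y, off => .branch .bne (reg x) (reg y) off
  | .bin .bne x y, off => .branch .beq (reg x) (reg y) off
  | .bin .blt x y, off => .branch .bge (reg x) (reg y) off
  | .bin .bge x y, off => .branch .blt (reg x) (reg y) off
  | .bin .bltu x y, off => .branch .bgeu (reg x) (reg y) off
  | .bin .bgeu x y, off => .branch .bltu (reg x) (reg y) off
  | .nez x, off => .branch .beq (reg x) zero off

/-- An inline table as raw words, padded with zero bytes. -/
def compileTable : List Byte → List Instr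
  | [] => []
  | [b₀] => [.invalid ((0 : BitVec 24) ++ b₀)]
  | [b₀, b₁] => [.invalid ((0 : BitVec 16) ++ b₁ ++ b₀)]
  | [b₀, b₁, b₂] => [.invalid ((0 : BitVec 8) ++ b₂ ++ b₁ ++ b₀)]
  | b₀ :: b₁ :: b₂ :: b₃ :: bs => .invalid (b₃ ++ b₂ ++ b₁ ++ b₀) :: compileTable bs

/-- The compilation of external calls, a parameter of the compiler. -/
abbrev ExtCompiler := List Var → ℕ → List Var → List Instr

/-- Positions of functions, in bytes relative to the start of the code. -/
abbrev FunPos := List (FunName × ℤ)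

/-- `pos` is the position of the output relative to the start of the code; the stack frame below
`sp + stackOffset` is free. -/
def compileStmt (ext : ExtCompiler) (env : FunPos) (pos stackOffset : ℤ) : Stmt → List Instr
  | .load sz x y o => [compileLoad sz x y o]
  | .store sz x y o => [compileStore sz x y o]
  | .inlinetable sz x t i =>
    let tbl := compileTable t
    .jal (reg x) (4 + 4 * (tbl.length : ℤ)) :: tbl
      ++ [.op .add (reg x) (reg x) (reg i), compileLoad sz x x 0]
  | .stackalloc x n s =>
    .opImm .addi (reg x) sp (stackOffset - n)
      :: compileStmt ext env (pos + 4) (stackOffset - n) s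
  | .lit x v => compileLit x v
  | .op x o y (.var z) => compileOpReg x o y z
  | .op x o y (.const c) => compileOpImm x o y c
  | .set x y => [.op .add (reg x) zero (reg y)]
  | .ite c s₁ s₂ =>
    let t₁ := compileStmt ext env (pos + 4) stackOffset s₁
    let t₂ := compileStmt ext env (pos + 4 + 4 * (t₁.length : ℤ) + 4) stackOffset s₂
    [compileCondInverted c (4 * ((t₁.length : ℤ) + 2))] ++ t₁
      ++ [.jal zero (4 * ((t₂.length : ℤ) + 1))] ++ t₂
  | .loop s₁ c s₂ =>
    let t₁ := compileStmt ext env pos stackOffset s₁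
    let t₂ := compileStmt ext env (pos + 4 * ((t₁.length : ℤ) + 1)) stackOffset s₂
    t₁ ++ [compileCondInverted c (4 * ((t₂.length : ℤ) + 2))] ++ t₂
      ++ [.jal zero (-4 * ((t₁.length : ℤ) + 1 + (t₂.length : ℤ)))]
  | .seq s₁ s₂ =>
    let t₁ := compileStmt ext env pos stackOffset s₁
    let t₂ := compileStmt ext env (pos + 4 * (t₁.length : ℤ)) stackOffset s₂
    t₁ ++ t₂
  | .skip => []
  | .call _ f _ => [.jal ra ((env.lookup f).getD 0 - pos)]
  | .interact binds a args => ext binds a args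

def Stmt.modVars : Stmt → List Var
  | .load _ x _ _ => [x]
  | .store _ _ _ _ => []
  | .inlinetable _ x _ _ => [x]
  | .stackalloc x _ s => union [x] s.modVars
  | .lit x _ => [x]
  | .op x _ _ _ => [x]
  | .set x _ => [x]
  | .ite _ s₁ s₂ => union s₁.modVars s₂.modVars
  | .loop s₁ _ s₂ => union s₁.modVars s₂.modVars
  | .seq s₁ s₂ => union s₁.modVars s₂.modVars
  | .skip => []
  | .call binds _ _ => union binds []
  | .interact binds _ _ => union binds []

/-- Number of words needed for the stack allocations of a statement. -/
def Stmt.allocWords : Stmt → ℕ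
  | .stackalloc _ n s => (n + 3) / 4 + s.allocWords
  | .ite _ s₁ s₂ => max s₁.allocWords s₂.allocWords
  | .loop s₁ _ s₂ => max s₁.allocWords s₂.allocWords
  | .seq s₁ s₂ => max s₁.allocWords s₂.allocWords
  | _ => 0

/-- Sizes of stack allocations are multiples of the word size. -/
def Stmt.allocsAligned : Stmt → Bool
  | .stackalloc _ n s => n % 4 == 0 && s.allocsAligned
  | .ite _ s₁ s₂ => s₁.allocsAligned && s₂.allocsAligned
  | .loop s₁ _ s₂ => s₁.allocsAligned && s₂.allocsAligned
  | .seq s₁ s₂ => s₁.allocsAligned && s₂.allocsAligned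
  | _ => true

def saveRegs : List Var → ℤ → List Instr
  | [], _ => []
  | x :: xs, o => .store .sw sp (reg x) o :: saveRegs xs (o + 4)

def loadRegs : List Var → ℤ → List Instr
  | [], _ => []
  | x :: xs, o => .load .lw (reg x) sp o :: loadRegs xs (o + 4)

/-- All modified registers other than those that hold results are saved by the callee. -/
def needToSave (f : Func Stmt) : List Var := diff f.body.modVars f.rets

/-- Size of the stack frame in words. -/
def frameWords (f : Func Stmt) : ℕ := (needToSave f).length + 1 + f.body.allocWords

def compileFunc (ext : ExtCompiler) (env : FunPos) (pos : ℤ) (f : Func Stmt) : List Instr :=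
  let saved := needToSave f
  let scratch : ℤ := 4 * (f.body.allocWords : ℤ)
  let frame : ℤ := 4 * (frameWords f : ℤ)
  [.opImm .addi sp sp (-frame), .store .sw sp ra (frame - 4)]
    ++ saveRegs saved scratch
    ++ compileStmt ext env (pos + 4 * (2 + (saved.length : ℤ))) scratch f.body
    ++ loadRegs saved scratch
    ++ [.load .lw ra sp (frame - 4), .opImm .addi sp sp frame, .jalr zero ra 0]

/-- Lay the functions out one after the other. -/
def layout (ext : ExtCompiler) (pos : ℤ) : List (Func Stmt) → FunPos
  | [] => []
  | f :: fs => (f.name, pos) :: layout ext (pos + 4 * ((compileFunc ext [] pos f).length : ℤ)) fs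

def compileFuncs (ext : ExtCompiler) (env : FunPos) (fs : List (Func Stmt)) : List Instr :=
  fs.flatMap (fun f => compileFunc ext env ((env.lookup f.name).getD 0) f)

def Stmt.callees : Stmt → List FunName
  | .stackalloc _ _ s => s.callees
  | .ite _ s₁ s₂ => union s₁.callees s₂.callees
  | .loop s₁ _ s₂ => union s₁.callees s₂.callees
  | .seq s₁ s₂ => union s₁.callees s₂.callees
  | .call _ f _ => [f]
  | _ => []

/-- Stack words used by a call of function `f`, following call chains of length at most `fuel`;
`none` for undefined functions and for longer chains (recursion). -/
def stackUsage (fs : List (Func Stmt)) : ℕ → FunName → Option ℕ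
  | 0, _ => none
  | fuel + 1, f => do
    let d ← fs.find? (fun d => d.name == f)
    let us ← d.body.callees.mapM (stackUsage fs fuel)
    return frameWords d + maxVar us

/-- Compiler output: the code, the positions of the functions in it, and the number of stack words
that suffices to call any of them. -/
structure Output where
  code : List Instr
  funPos : FunPos
  stackWords : ℕ
  deriving DecidableEq

/-- The compiler. It fails if there are duplicate, recursive or undefined functions, calls with more
than eight arguments or results, misaligned stack allocations, or offsets that are too large. -/
def compile (ext : ExtCompiler) (prog : List (Func Cmd)) : Option Output := do
  let optimized := prog.map (fun f =>
    let g := flattenFunc f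
    regAllocFunc { g with body := deadCodeElim (useImmediate g.body) g.rets })
  let fs ← optimized.mapM spillFunc
  let env := layout ext 0 fs
  let code := compileFuncs ext env fs
  let usages ← fs.mapM (fun f => stackUsage fs fs.length f.name)
  if (fs.map Func.name).Nodup && fs.all (fun f => f.body.allocsAligned)
      && code.all Instr.encodable then
    some { code := code, funPos := env, stackWords := maxVar usages }
  else none

/-- No external calls. -/
def noExt : ExtCompiler := fun _ _ _ => []

end Bedrock2

namespace RiscV

/-! ### Loads, stores and encoded words -/

/-! The program is fixed, so the compiler can simply be evaluated: `compile_memequal` gives 39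
concrete instructions, and no correctness theorem for the six phases is needed. What remains is a
symbolic execution of this code along a trace guessed in advance.

The trace consists of `prologueTrace`, `loopTrace` and `epilogueTrace`. It can be written down from
the public words because branches test only the counter, loads and stores go to `x + i`, `y + i` or
fixed frame offsets, and the indirect jump goes to the return address. A loaded array byte flows
only into the temporaries, the accumulator and the result, none of which is used as an address, a
branch operand or a jump target. In the proof this appears as universal quantification: the
continuation after `loadByte` must work for every loaded value.

The invariant `Activation.Running` says that the trace leaked so far followed by the trace still
predicted is `finalK`. There is one rule per kind of instruction, and each consumes the head of the
prediction. Functional correctness is not tracked. About memory, only three facts must survive: the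
code is intact and executable, the addresses to be accessed are mapped, and the saved return address
is in its slot. All stores go to the stack frame, which is disjoint from the code, so
`Activation.Running.store` preserves these facts. The loop is handled by induction on the counter in
`runsTo_loop`. -/

theorem loadBytes_one {m : Mem} {a : Word} (h : (m a).isSome) :
    ∃ v, loadBytes m a 1 = some v := by
  obtain ⟨b, hb⟩ := Option.isSome_iff_exists.1 h
  exact ⟨b.toNat, by simp [loadBytes, hb]⟩

theorem loadBytes_four {m : Mem} {a : Word} {b : ℕ → Byte}
    (h : ∀ j < 4, m (a + BitVec.ofNat 32 j) = some (b j)) :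
    loadBytes m a 4 =
      some ((b 0).toNat + 256 * ((b 1).toNat + 256 * ((b 2).toNat + 256 * (b 3).toNat))) := by
  have h0 : m a = some (b 0) := by simpa using h 0 (by norm_num)
  have h1 : m (a + 1) = some (b 1) := h 1 (by norm_num)
  have h2 : m (a + 1 + 1) = some (b 2) := by
    rw [BitVec.add_assoc]; exact h 2 (by norm_num)
  have h3 : m (a + 1 + 1 + 1) = some (b 3) := by
    rw [BitVec.add_assoc, BitVec.add_assoc]; exact h 3 (by norm_num)
  simp only [loadBytes, h0, h1, h2, h3, Option.bind_eq_bind, Option.bind_some, Option.pure_def,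
    Nat.mul_zero, Nat.add_zero]

theorem loadBytes_four_isSome {m : Mem} {a : Word}
    (h : ∀ j < 4, (m (a + BitVec.ofNat 32 j)).isSome) : ∃ v, loadBytes m a 4 = some v :=
  ⟨_, loadBytes_four (b := fun j => (m (a + BitVec.ofNat 32 j)).getD 0) fun j hj => by
    obtain ⟨b, hb⟩ := Option.isSome_iff_exists.1 (h j hj)
    simp [hb]⟩

/-- The four extracted bytes are the base-256 digits of `w`. This serves both instruction fetch and
the reload of the return address. -/
theorem loadBytes_four_word {m : Mem} {a w : Word}
    (h : ∀ j < 4, m (a + BitVec.ofNat 32 j) = some (w.extractLsb' (8 * j) 8)) :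
    (loadBytes m a 4).map (BitVec.ofNat 32) = some w := by
  rw [loadBytes_four h, Option.map_some, Option.some_inj]
  apply BitVec.eq_of_toNat_eq
  have := w.isLt
  simp only [BitVec.toNat_ofNat, BitVec.extractLsb'_toNat, Nat.shiftRight_eq_div_pow]
  norm_num
  omega

theorem wordBytes_getElem? (w : Word) {j : ℕ} (hj : j < 4) :
    (wordBytes w)[j]? = some (w.extractLsb' (8 * j) 8) := by
  interval_cases j <;> rfl

theorem flatMap_wordBytes_getElem? (f : Instr → Word) (code : List Instr) {k j : ℕ} {i : Instr}
    (hk : code[k]? = some i) (hj : j < 4) :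
    (code.flatMap fun i => wordBytes (f i))[4 * k + j]? =
      some ((f i).extractLsb' (8 * j) 8) := by
  induction code generalizing k with
  | nil => simp at hk
  | cons c cs ih =>
    have hlen : (wordBytes (f c)).length = 4 := rfl
    rw [List.flatMap_cons]
    cases k with
    | zero =>
      rw [List.getElem?_append_left (by omega), Nat.mul_zero, Nat.zero_add]
      obtain rfl : c = i := by simpa using hk
      exact wordBytes_getElem? _ hj
    | succ k =>
      rw [List.getElem?_append_right (by omega), hlen, ← ih (by simpa using hk)]
      congr 1
      omega

/-- A store changes values but never unmaps an address. This suffices for the arrays and the saved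
registers, whose contents do not matter. -/
theorem storeBytes_isSome {m m' : Mem} {a : Word} {k : ℕ} {v : Word}
    (h : storeBytes m a k v = some m') {b : Word} (hb : (m b).isSome) : (m' b).isSome := by
  unfold storeBytes at h
  split at h
  · obtain rfl := Option.some_inj.1 h
    dsimp only
    split <;> simp [hb]
  · simp at h

/-- An indirect jump clears bit 0 of its target; for an aligned return address this changes nothing.
-/
theorem and_not_one_of_aligned {a : Word} (h : a.toNat % 4 = 0) : a &&& ~~~(1 : Word) = a := by
  have h0 : a.getLsbD 0 = false := by
    simp only [BitVec.getLsbD, Nat.testBit_zero, decide_eq_false_iff_not]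
    omega
  apply BitVec.eq_of_getLsbD_eq
  intro i hi
  rw [BitVec.getLsbD_and, BitVec.getLsbD_not, show (1 : Word) = 1#32 from rfl, BitVec.getLsbD_one]
  rcases Nat.eq_zero_or_pos i with rfl | hi0
  · rw [h0, Bool.false_and]
  · simp [hi, hi0.ne']

/-- Wrap-around is harmless for alignment, since 4 divides `2 ^ 32`. -/
theorem toNat_add_ofNat_mod_four {a : Word} (h : a.toNat % 4 = 0) (k : ℕ) :
    (a + BitVec.ofNat 32 (4 * k)).toNat % 4 = 0 := by
  rw [BitVec.toNat_add, BitVec.toNat_ofNat]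
  omega

/-! ### Register files -/

/-- The value of the register `r` in the register file `R`. -/
def readReg (R : Reg → Word) (r : Reg) : Word := if r = 0 then 0 else R r

/-- The register file `R` with the register `r` set to `v`. -/
def writeReg (R : Reg → Word) (r : Reg) (v : Word) : Reg → Word :=
  fun r' => if r' = r then v else R r'

theorem readReg_of_ne (R : Reg → Word) {r : Reg} (h : r ≠ 0) : readReg R r = R r := if_neg h

/-! ### Running a piece of code with a predicted leakage trace -/

/-- The leakage of executing instructions at the given indices of the code at address `pos`. -/
def events (pos : Word) (T : List (ℕ × InstrLeakage)) : List LeakageEvent :=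
  T.flatMap fun p => [.fetch (pos + BitVec.ofNat 32 (4 * p.1)), .exec p.2]

/-- What stays fixed during an activation of a function: its code, the stack frame, the return
address, which is saved in the frame at offset `slot`, the other addresses known to be
mapped, and the leakage trace of the whole run. -/
structure Activation where
  code : List Instr
  pos : Word
  frame : Word
  slot : ℕ
  retAddr : Word
  mapped : Set Word
  finalK : List LeakageEvent
  decodes : ∀ i ∈ code, decode (encode i) = i
  aligned : pos.toNat % 4 = 0
  slot_lt : slot + 4 ≤ 2 ^ 32
  frame_disjoint : ∀ i < slot + 4, ∀ j < 4 * code.length,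
    frame + BitVec.ofNat 32 i ≠ pos + BitVec.ofNat 32 j
  frame_mapped : ∀ i < slot + 4, frame + BitVec.ofNat 32 i ∈ mapped

/-- The machine is about to execute instruction number `k`, its registers are `R`, and it must
still leak the trace `T`. If `saved` holds, the return address is in its slot. -/
structure Activation.Running (A : Activation) (saved : Prop) (k : ℕ) (R : Reg → Word)
    (T : List (ℕ × InstrLeakage)) (m : Machine) : Prop where
  pc : m.pc = A.pos + BitVec.ofNat 32 (4 * k)
  regs : m.regs = R
  leakage : m.leakage ++ events A.pos T = A.finalK
  code : ∀ k i, A.code[k]? = some i → ∀ j < 4,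
    m.mem (A.pos + BitVec.ofNat 32 (4 * k + j)) = some ((encode i).extractLsb' (8 * j) 8)
  executable : ∀ j < 4 * A.code.length, m.xaddrs (A.pos + BitVec.ofNat 32 j) = true
  mapped : ∀ a ∈ A.mapped, (m.mem a).isSome
  slot : saved → ∀ j < 4, m.mem (A.frame + BitVec.ofNat 32 (A.slot + j)) =
    some (A.retAddr.extractLsb' (8 * j) 8)

namespace Activation.Running

variable {A : Activation} {saved : Prop} {k : ℕ} {R : Reg → Word} {T : List (ℕ × InstrLeakage)}
  {m : Machine} {Q : Machine → Prop}

theorem fetch_eq {i : Instr} (h : A.Running saved k R T m) (hi : A.code[k]? = some i) :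
    fetch m = some (encode i) := by
  have hk : k < A.code.length := (List.getElem?_eq_some_iff.1 hi).1
  have hx : (List.range 4).all (fun j => m.xaddrs (m.pc + BitVec.ofNat 32 j)) = true := by
    rw [List.all_eq_true]
    intro j hj
    rw [List.mem_range] at hj
    rw [h.pc, BitVec.add_assoc, ← BitVec.ofNat_add]
    exact h.executable _ (by omega)
  rw [fetch, if_pos hx]
  apply loadBytes_four_word
  intro j hj
  rw [h.pc, BitVec.add_assoc, ← BitVec.ofNat_add]
  exact h.code k i hi j hj

theorem step {i : Instr} {l : InstrLeakage} {m' : Machine}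
    (h : A.Running saved k R T m) (hi : A.code[k]? = some i) (hl : leakageOf m i = some l)
    (he : execute { m with leakage := m.leakage ++ [.fetch m.pc, .exec l] } i = some m')
    (hm' : RunsTo m' Q) : RunsTo m Q := by
  refine .step ?_ hm'
  have hd : decode (encode i) = i := A.decodes i (List.mem_of_getElem? hi)
  simp [RiscV.step, h.fetch_eq hi, hd, hl, he]

/-- A step that changes only the registers, the program counter and the leakage trace. -/
theorem of_update {k' : ℕ} {R' : Reg → Word} {l : InstrLeakage} {pc' : Word}
    (h : A.Running saved k R ((k, l) :: T) m) (hpc : pc' = A.pos + BitVec.ofNat 32 (4 * k')) :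
    A.Running saved k' R' T
      { m with
        regs := R'
        pc := pc'
        leakage := m.leakage ++ [.fetch m.pc, .exec l] } :=
  { pc := hpc
    regs := rfl
    leakage := by
      rw [← h.leakage, h.pc]
      simp [events]
    code := h.code
    executable := h.executable
    mapped := h.mapped
    slot := h.slot }

/-! ### Symbolic execution rules, one for each kind of instruction -/

theorem pc_next (h : A.Running saved k R T m) :
    m.pc + 4 = A.pos + BitVec.ofNat 32 (4 * (k + 1)) := by
  rw [h.pc, BitVec.add_assoc, Nat.mul_succ, BitVec.ofNat_add]
  rfl

/-- The result is passed on as a variable `v` with a separate equation, so that a caller can forget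
a value that the leakage does not depend on, and register files stay small terms. -/
theorem opImm {o : ImmOp} {rd rs : Reg} {c : ℤ}
    (h : A.Running saved k R ((k, .opImm o) :: T) m)
    (hi : A.code[k]? = some (.opImm o rd rs c))
    (hQ : ∀ v m', v = o.eval (readReg R rs) c → A.Running saved (k + 1) (writeReg R rd v) T m' →
      RunsTo m' Q) :
    RunsTo m Q := by
  obtain rfl := h.regs
  exact h.step hi rfl rfl (hQ _ _ rfl (h.of_update h.pc_next))

/-- The condition `ho` singles out the operations whose leakage is independent of their operands,
excluding shifts, divisions and remainders. -/
theorem op {o : AluOp} {rd r₁ r₂ : Reg}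
    (h : A.Running saved k R ((k, .op o) :: T) m)
    (hi : A.code[k]? = some (.op o rd r₁ r₂))
    (ho : ∀ a b, leakOp o a b = .op o)
    (hQ : ∀ v m', v = o.eval (readReg R r₁) (readReg R r₂) →
      A.Running saved (k + 1) (writeReg R rd v) T m' → RunsTo m' Q) :
    RunsTo m Q := by
  obtain rfl := h.regs
  exact h.step hi (congrArg some (ho _ _)) rfl (hQ _ _ rfl (h.of_update h.pc_next))

theorem load {o : LoadOp} {rd rs : Reg} {off : ℤ} {a : Word} {v : ℕ}
    (h : A.Running saved k R ((k, .load o a) :: T) m)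
    (hi : A.code[k]? = some (.load o rd rs off))
    (ha : readReg R rs + BitVec.ofInt 32 off = a)
    (hv : loadBytes m.mem a o.bytes = some v)
    (hQ : ∀ m', A.Running saved (k + 1) (writeReg R rd (o.extend v)) T m' → RunsTo m' Q) :
    RunsTo m Q := by
  obtain rfl := h.regs
  refine h.step hi (l := .load o a) (congrArg (fun v => some (InstrLeakage.load o v)) ha) ?_
    (hQ _ (h.of_update h.pc_next))
  change (loadBytes m.mem (readReg m.regs rs + BitVec.ofInt 32 off) o.bytes).bind _ = _
  rw [ha, hv]
  rfl

/-- Here secrets enter the registers: the address is predicted, but the continuation must cope with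
an arbitrary `v`. -/
theorem loadByte {rd rs : Reg} {off : ℤ} {a : Word}
    (h : A.Running saved k R ((k, .load .lbu a) :: T) m)
    (hi : A.code[k]? = some (.load .lbu rd rs off))
    (ha : readReg R rs + BitVec.ofInt 32 off = a) (hm : a ∈ A.mapped)
    (hQ : ∀ v m', A.Running saved (k + 1) (writeReg R rd v) T m' → RunsTo m' Q) :
    RunsTo m Q := by
  obtain ⟨v, hv⟩ := loadBytes_one (h.mapped a hm)
  exact h.load hi ha hv (hQ _)

/-- Reloaded callee-saved registers may hold anything, because the conclusion concerns only the
program counter and the leakage; the frame being mapped is enough. -/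
theorem restore {rd rs : Reg} {off : ℤ} {j : ℕ} {a : Word}
    (h : A.Running saved k R ((k, .load .lw a) :: T) m)
    (hi : A.code[k]? = some (.load .lw rd rs off))
    (ha : readReg R rs + BitVec.ofInt 32 off = a)
    (hj : a = A.frame + BitVec.ofNat 32 j) (hjs : j ≤ A.slot)
    (hQ : ∀ v m', A.Running saved (k + 1) (writeReg R rd v) T m' → RunsTo m' Q) :
    RunsTo m Q := by
  obtain ⟨v, hv⟩ : ∃ v, loadBytes m.mem a 4 = some v := by
    apply loadBytes_four_isSome
    intro t ht
    rw [hj, BitVec.add_assoc, ← BitVec.ofNat_add]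
    exact h.mapped _ (A.frame_mapped _ (by omega))
  exact h.load hi ha hv (hQ _)

/-- The return address is the one data word in memory whose value matters, since the final jump both
leaks it and goes there. -/
theorem restoreRetAddr {rd rs : Reg} {off : ℤ} {a : Word}
    (h : A.Running True k R ((k, .load .lw a) :: T) m)
    (hi : A.code[k]? = some (.load .lw rd rs off))
    (ha : readReg R rs + BitVec.ofInt 32 off = a)
    (hj : a = A.frame + BitVec.ofNat 32 A.slot)
    (hQ : ∀ m', A.Running True (k + 1) (writeReg R rd A.retAddr) T m' → RunsTo m' Q) :
    RunsTo m Q := by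
  have hw : (loadBytes m.mem a 4).map (BitVec.ofNat 32) = some A.retAddr := by
    apply loadBytes_four_word
    intro t ht
    rw [hj, BitVec.add_assoc, ← BitVec.ofNat_add]
    exact h.slot trivial t ht
  obtain ⟨v, hv, hvw⟩ := Option.map_eq_some_iff.1 hw
  refine h.load hi ha hv ?_
  rwa [show LoadOp.lw.extend v = A.retAddr from hvw]

/-- A store to the frame misses the code by disjointness. The slot holds the return address
afterwards if this store puts it there, or if it was there already and the store ends below the
slot. -/
theorem store {saved' : Prop} {rs₁ rs₂ : Reg} {off : ℤ} {j : ℕ} {a : Word}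
    (h : A.Running saved k R ((k, .store .sw a) :: T) m)
    (hi : A.code[k]? = some (.store .sw rs₁ rs₂ off))
    (ha : readReg R rs₁ + BitVec.ofInt 32 off = a)
    (hj : a = A.frame + BitVec.ofNat 32 j) (hjs : j ≤ A.slot)
    (hs : saved' → j = A.slot ∧ readReg R rs₂ = A.retAddr ∨ j + 4 ≤ A.slot ∧ saved)
    (hQ : ∀ m', A.Running saved' (k + 1) R T m' → RunsTo m' Q) :
    RunsTo m Q := by
  obtain rfl := h.regs
  have hall : (List.range 4).all (fun i => (m.mem (a + BitVec.ofNat 32 i)).isSome) = true := by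
    rw [List.all_eq_true]
    intro t ht
    rw [List.mem_range] at ht
    rw [hj, BitVec.add_assoc, ← BitVec.ofNat_add]
    exact h.mapped _ (A.frame_mapped _ (by omega))
  obtain ⟨mem', hmem'⟩ : ∃ mem', storeBytes m.mem a 4 (readReg m.regs rs₂) = some mem' :=
    ⟨_, if_pos hall⟩
  have hval : ∀ b, mem' b = if (b - a).toNat < 4 then
      some ((readReg m.regs rs₂).extractLsb' (8 * (b - a).toNat) 8) else m.mem b := by
    rw [storeBytes, if_pos hall, Option.some_inj] at hmem'
    simp [← hmem']
  -- A code byte at distance `d < 4` from the stored address would be the frame byte at offset `j +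
  -- d`.
  have hcode : ∀ t < 4 * A.code.length, ¬ (A.pos + BitVec.ofNat 32 t - a).toNat < 4 := by
    intro t ht hlt
    refine A.frame_disjoint (j + (A.pos + BitVec.ofNat 32 t - a).toNat) (by omega) t ht ?_
    rw [BitVec.ofNat_add, BitVec.ofNat_toNat, BitVec.setWidth_eq, ← BitVec.add_assoc, ← hj,
      BitVec.add_comm, BitVec.sub_add_cancel]
  -- The distance from offset `j` to offset `t`, modulo `2 ^ 32`. By `slot_lt` it does not wrap
  -- around when `j ≤ t`, which separates the slot from stores below it.
  have hdist : ∀ t < A.slot + 4, (A.frame + BitVec.ofNat 32 t - a).toNat =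
      (t + (2 ^ 32 - j)) % 2 ^ 32 := by
    intro t ht
    have := A.slot_lt
    rw [hj, BitVec.toNat_sub, BitVec.toNat_add, BitVec.toNat_add, BitVec.toNat_ofNat,
      BitVec.toNat_ofNat]
    omega
  refine h.step hi (l := .store .sw a)
    (m' := { m with
      mem := mem'
      xaddrs := fun b => if (b - a).toNat < 4 then false else m.xaddrs b
      pc := m.pc + 4
      leakage := m.leakage ++ [.fetch m.pc, .exec (.store .sw a)] }) (congrArg (fun v => some (InstrLeakage.store .sw v)) ha) ?_ (hQ _ ?_)
  · change (storeBytes m.mem (readReg m.regs rs₁ + BitVec.ofInt 32 off) 4 (readReg m.regs rs₂)).bind _ = _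
    subst ha
    rw [hmem']
    rfl
  · refine ⟨h.pc_next, h.regs, ?_, ?_, ?_, ?_, ?_⟩
    · rw [← h.leakage, h.pc]
      simp [events]
    · intro k i hki t ht
      have hk : k < A.code.length := (List.getElem?_eq_some_iff.1 hki).1
      simp only [hval, if_neg (hcode (4 * k + t) (by omega)), h.code k i hki t ht]
    · intro t ht
      simp only [if_neg (hcode t ht), h.executable t ht]
    · exact fun b hb => storeBytes_isSome hmem' (h.mapped b hb)
    · intro hs' t ht
      have hslot := A.slot_lt
      simp only [hval, hdist (A.slot + t) (by omega)]
      rcases hs hs' with ⟨rfl, hr⟩ | ⟨hlt, hsv⟩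
      · rw [show (A.slot + t + (2 ^ 32 - A.slot)) % 2 ^ 32 = t by omega, if_pos ht, hr]
      · rw [if_neg (by omega), h.slot hsv t ht]

theorem branchNotTaken {c : BranchOp} {r₁ r₂ : Reg} {off : ℤ}
    (h : A.Running saved k R ((k, .branch c false) :: T) m)
    (hi : A.code[k]? = some (.branch c r₁ r₂ off))
    (hc : c.taken (readReg R r₁) (readReg R r₂) = false)
    (hQ : ∀ m', A.Running saved (k + 1) R T m' → RunsTo m' Q) :
    RunsTo m Q := by
  obtain rfl := h.regs
  refine h.step hi (l := .branch c false) (congrArg (fun v => some (InstrLeakage.branch c v)) hc) ?_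
    (hQ _ (h.of_update h.pc_next))
  change (if c.taken (readReg m.regs r₁) (readReg m.regs r₂) then _ else _) = _
  rw [hc]
  rfl

/-- The target condition `hk` is an equation of words, so for concrete indices and offsets it is
closed by computation, also for negative offsets. -/
theorem branchTaken {c : BranchOp} {r₁ r₂ : Reg} {off : ℤ} {k' : ℕ}
    (h : A.Running saved k R ((k, .branch c true) :: T) m)
    (hi : A.code[k]? = some (.branch c r₁ r₂ off))
    (hc : c.taken (readReg R r₁) (readReg R r₂) = true)
    (hk : BitVec.ofNat 32 (4 * k) + BitVec.ofInt 32 off = BitVec.ofNat 32 (4 * k'))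
    (hQ : ∀ m', A.Running saved k' R T m' → RunsTo m' Q) :
    RunsTo m Q := by
  have hpc : m.pc + BitVec.ofInt 32 off = A.pos + BitVec.ofNat 32 (4 * k') := by
    rw [h.pc, BitVec.add_assoc, hk]
  obtain rfl := h.regs
  refine h.step hi (l := .branch c true) (congrArg (fun v => some (InstrLeakage.branch c v)) hc) ?_
    (hQ _ (h.of_update hpc))
  change (if c.taken (readReg m.regs r₁) (readReg m.regs r₂) then Machine.jump _ _ else _) = _
  rw [hc, if_pos rfl]
  refine if_pos ?_
  rw [hpc]
  exact toNat_add_ofNat_mod_four A.aligned _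

theorem jal {rd : Reg} {off : ℤ} {k' : ℕ}
    (h : A.Running saved k R ((k, .jal) :: T) m)
    (hi : A.code[k]? = some (.jal rd off))
    (hk : BitVec.ofNat 32 (4 * k) + BitVec.ofInt 32 off = BitVec.ofNat 32 (4 * k'))
    (hQ : ∀ v m', A.Running saved k' (writeReg R rd v) T m' → RunsTo m' Q) :
    RunsTo m Q := by
  have hpc : m.pc + BitVec.ofInt 32 off = A.pos + BitVec.ofNat 32 (4 * k') := by
    rw [h.pc, BitVec.add_assoc, hk]
  obtain rfl := h.regs
  refine h.step hi (l := .jal) rfl (if_pos ?_) (hQ (m.pc + 4) _ (h.of_update hpc))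
  rw [hpc]
  exact toNat_add_ofNat_mod_four A.aligned _

/-- The return from the function ends the run. -/
theorem ret {rs : Reg}
    (h : A.Running saved k R [(k, .jalr A.retAddr)] m)
    (hi : A.code[k]? = some (.jalr zero rs 0))
    (hr : readReg R rs = A.retAddr) (ha : A.retAddr.toNat % 4 = 0) :
    RunsTo m (fun m' => m'.pc = A.retAddr ∧ m'.leakage = A.finalK) := by
  obtain rfl := h.regs
  have hpc : (readReg m.regs rs + BitVec.ofInt 32 0) &&& ~~~(1 : Word) = A.retAddr := by
    rw [hr, show BitVec.ofInt 32 0 = 0#32 from rfl, BitVec.add_zero, and_not_one_of_aligned ha]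
  refine h.step hi (l := .jalr A.retAddr) (congrArg (fun v => some (InstrLeakage.jalr v)) hr) (if_pos ?_)
    (.done ⟨hpc, ?_⟩)
  · change ((readReg m.regs rs + BitVec.ofInt 32 0) &&& ~~~(1 : Word)).toNat % 4 = 0
    rw [hpc, ha]
  · rw [← h.leakage, h.pc]
    simp [events, Machine.setReg]

end Activation.Running

end RiscV

namespace Bedrock2

open RiscV

/-! ### The machine code of `memequal` and its leakage -/

/-- Register allocation puts `x`, `y`, `n`, `r` into registers 6, 7, 8, 9, with 18, 19, 20 as
temporaries. Indices 0–14 are the prologue, 15–23 the loop, 24–38 the epilogue. -/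
def memequalCode : List Instr :=
  [.opImm .addi 2 2 (-36), .store .sw 2 1 32, .store .sw 2 5 0, .store .sw 2 18 4,
    .store .sw 2 19 8, .store .sw 2 20 12, .store .sw 2 7 16, .store .sw 2 8 20,
    .store .sw 2 6 24, .store .sw 2 9 28, .opImm .addi 5 2 0, .op .add 6 0 10,
    .op .add 7 0 11, .op .add 8 0 12, .opImm .addi 9 0 0, .branch .beq 8 0 36,
    .load .lbu 18 6 0, .load .lbu 19 7 0, .op .xor 20 18 19, .op .or 9 9 20,
    .opImm .addi 6 6 1, .opImm .addi 7 7 1, .opImm .addi 8 8 (-1), .jal 0 (-32),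
    .opImm .addi 6 0 0, .op .sub 9 9 6, .opImm .sltiu 9 9 1, .op .add 10 0 9,
    .load .lw 5 2 0, .load .lw 18 2 4, .load .lw 19 2 8, .load .lw 20 2 12, .load .lw 7 2 16,
    .load .lw 8 2 20, .load .lw 6 2 24, .load .lw 9 2 28, .load .lw 1 2 32,
    .opImm .addi 2 2 36, .jalr 0 1 0]

/-- Pure evaluation. The 9 stack words are the eight saved registers and the return address; nothing
is spilled. -/
theorem compile_memequal :
    compile noExt [memequal] = some ⟨memequalCode, [(memequalName, 0)], 9⟩ := by rfl

theorem decode_encode_memequalCode : ∀ i ∈ memequalCode, decode (encode i) = i := by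
  decide +kernel

def prologueTrace (frame : Word) : List (ℕ × InstrLeakage) :=
  [(0, .opImm .addi),
    (1, .store .sw (frame + BitVec.ofNat 32 32)), (2, .store .sw (frame + BitVec.ofNat 32 0)),
    (3, .store .sw (frame + BitVec.ofNat 32 4)), (4, .store .sw (frame + BitVec.ofNat 32 8)),
    (5, .store .sw (frame + BitVec.ofNat 32 12)), (6, .store .sw (frame + BitVec.ofNat 32 16)),
    (7, .store .sw (frame + BitVec.ofNat 32 20)), (8, .store .sw (frame + BitVec.ofNat 32 24)),
    (9, .store .sw (frame + BitVec.ofNat 32 28)),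
    (10, .opImm .addi), (11, .op .add), (12, .op .add), (13, .op .add), (14, .opImm .addi)]

/-- The recursion sees the number of remaining iterations and the two current addresses, never the
bytes stored there. -/
def loopTrace : ℕ → Word → Word → List (ℕ × InstrLeakage)
  | 0, _, _ => [(15, .branch .beq true)]
  | n + 1, x, y =>
    [(15, .branch .beq false), (16, .load .lbu x), (17, .load .lbu y), (18, .op .xor),
      (19, .op .or), (20, .opImm .addi), (21, .opImm .addi), (22, .opImm .addi), (23, .jal)]
      ++ loopTrace n (x + 1) (y + 1)

def epilogueTrace (frame retAddr : Word) : List (ℕ × InstrLeakage) :=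
  [(24, .opImm .addi), (25, .op .sub), (26, .opImm .sltiu), (27, .op .add),
    (28, .load .lw (frame + BitVec.ofNat 32 0)), (29, .load .lw (frame + BitVec.ofNat 32 4)),
    (30, .load .lw (frame + BitVec.ofNat 32 8)), (31, .load .lw (frame + BitVec.ofNat 32 12)),
    (32, .load .lw (frame + BitVec.ofNat 32 16)), (33, .load .lw (frame + BitVec.ofNat 32 20)),
    (34, .load .lw (frame + BitVec.ofNat 32 24)), (35, .load .lw (frame + BitVec.ofNat 32 28)),
    (36, .load .lw (frame + BitVec.ofNat 32 32)),
    (37, .opImm .addi), (38, .jalr retAddr)]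

/-! ### Execution of `memequal` -/

variable {A : Activation} {R : Reg → Word} {m : Machine} {Q : Machine → Prop}

theorem runsTo_prologue (hcode : A.code = memequalCode) (hslot : A.slot = 32)
    {T : List (ℕ × InstrLeakage)} {x y n : Word}
    (h : A.Running False 0 R (prologueTrace A.frame ++ T) m)
    (hsp : R 2 = A.frame + 36) (hra : R 1 = A.retAddr)
    (hx : R 10 = x) (hy : R 11 = y) (hn : R 12 = n)
    (hQ : ∀ R' m', A.Running True 15 R' T m' → R' 2 = A.frame → R' 6 = x → R' 7 = y → R' 8 = n →
      RunsTo m' Q) :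
    RunsTo m Q := by
  have hi {k : ℕ} {i : Instr} (h : memequalCode[k]? = some i) : A.code[k]? = some i := by
    rw [hcode, h]
  have hframe : A.frame + 36 + BitVec.ofInt 32 (-36) = A.frame := by
    rw [BitVec.add_assoc]
    exact BitVec.add_zero _
  refine h.opImm (hi rfl) fun S m hS h => ?_
  obtain rfl : S = A.frame := by
    rw [hS, readReg_of_ne _ (by decide), hsp]
    exact hframe
  -- The return address is stored first, at the top of the frame; from here on the slot is known to
  -- hold it.
  refine h.store (saved' := True) (hi rfl) rfl rfl hslot.ge (fun _ => .inl ⟨hslot.symm, hra⟩)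
    fun m h => ?_
  -- The eight callee-saved registers go to offsets 0 to 28, all below the slot at 32.
  iterate 8
    refine h.store (saved' := True) (hi rfl) rfl rfl (by omega)
      (fun _ => .inr ⟨by omega, trivial⟩) fun m h => ?_
  refine h.opImm (hi rfl) fun v₅ m h₅ h => ?_
  refine h.op (hi rfl) (fun _ _ => rfl) fun v₆ m h₆ h => ?_
  refine h.op (hi rfl) (fun _ _ => rfl) fun v₇ m h₇ h => ?_
  refine h.op (hi rfl) (fun _ _ => rfl) fun v₈ m h₈ h => ?_
  refine h.opImm (hi rfl) fun v₉ m h₉ h => hQ _ _ h rfl (h₆.trans ?_) (h₇.trans ?_) (h₈.trans ?_)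
  · exact (BitVec.zero_add _).trans hx
  · exact (BitVec.zero_add _).trans hy
  · exact (BitVec.zero_add _).trans hn

/-- Induction on the counter with addresses, registers and machine generalized. The invariant fixes
only the stack pointer, the two addresses and the counter, so the accumulator and the temporaries
stay arbitrary. -/
theorem runsTo_loop (hcode : A.code = memequalCode) {T : List (ℕ × InstrLeakage)} (n : ℕ)
    (hn32 : n < 2 ^ 32) (x y : Word)
    (hxs : ∀ i < n, x + BitVec.ofNat 32 i ∈ A.mapped)
    (hys : ∀ i < n, y + BitVec.ofNat 32 i ∈ A.mapped)
    (h : A.Running True 15 R (loopTrace n x y ++ T) m)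
    (hsp : R 2 = A.frame) (hx : R 6 = x) (hy : R 7 = y) (hn : R 8 = BitVec.ofNat 32 n)
    (hQ : ∀ R' m', A.Running True 24 R' T m' → R' 2 = A.frame → RunsTo m' Q) :
    RunsTo m Q := by
  have hi {k : ℕ} {i : Instr} (h : memequalCode[k]? = some i) : A.code[k]? = some i := by
    rw [hcode, h]
  induction n generalizing x y R m with
  | zero =>
    refine h.branchTaken (hi rfl) ?_ rfl fun m h => hQ _ _ h hsp
    change (R 8 == 0) = true
    rw [hn]
    rfl
  | succ n ih =>
    refine h.branchNotTaken (hi rfl) ?_ fun m h => ?_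
    · change (R 8 == 0) = false
      rw [hn, beq_eq_false_iff_ne]
      -- The bound `hn32` matters here: without it the counter could be zero as a word while
      -- iterations remain.
      intro h0
      have := congrArg BitVec.toNat h0
      rw [BitVec.toNat_ofNat, show (0 : Word).toNat = 0 from rfl] at this
      omega
    refine h.loadByte (hi rfl) ((BitVec.add_zero _).trans hx) (by simpa using hxs 0 n.succ_pos)
      fun v m h => ?_
    refine h.loadByte (hi rfl) ((BitVec.add_zero _).trans hy) (by simpa using hys 0 n.succ_pos)
      fun w m h => ?_
    refine h.op (hi rfl) (fun _ _ => rfl) fun v₂₀ m _ h => ?_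
    refine h.op (hi rfl) (fun _ _ => rfl) fun v₉ m _ h => ?_
    refine h.opImm (hi rfl) fun v₆ m h₆ h => ?_
    refine h.opImm (hi rfl) fun v₇ m h₇ h => ?_
    refine h.opImm (hi rfl) fun v₈ m h₈ h => ?_
    refine h.jal (hi rfl) (k' := 15) rfl fun v m h => ?_
    have hsucc (a : Word) (i : ℕ) :
        a + 1 + BitVec.ofNat 32 i = a + BitVec.ofNat 32 (i + 1) := by
      rw [BitVec.add_assoc, Nat.add_comm, BitVec.ofNat_add]
      rfl
    refine ih (by omega) (x + 1) (y + 1) (fun i hin => ?_) (fun i hin => ?_) h ?_ ?_ ?_ ?_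
    · rw [hsucc]; exact hxs _ (by omega)
    · rw [hsucc]; exact hys _ (by omega)
    · exact hsp
    · exact h₆.trans (congrArg (· + 1) hx)
    · exact h₇.trans (congrArg (· + 1) hy)
    · refine h₈.trans ?_
      change R 8 + BitVec.ofInt 32 (-1) = _
      rw [hn, BitVec.ofNat_add, BitVec.add_assoc]
      exact BitVec.add_zero _

theorem runsTo_epilogue (hcode : A.code = memequalCode) (hslot : A.slot = 32)
    (h : A.Running True 24 R (epilogueTrace A.frame A.retAddr) m)
    (hsp : R 2 = A.frame) (hret : A.retAddr.toNat % 4 = 0) :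
    RunsTo m (fun m' => m'.pc = A.retAddr ∧ m'.leakage = A.finalK) := by
  have hi {k : ℕ} {i : Instr} (h : memequalCode[k]? = some i) : A.code[k]? = some i := by
    rw [hcode, h]
  refine h.opImm (hi rfl) fun _ m _ h => ?_
  refine h.op (hi rfl) (fun _ _ => rfl) fun _ m _ h => ?_
  refine h.opImm (hi rfl) fun _ m _ h => ?_
  refine h.op (hi rfl) (fun _ _ => rfl) fun _ m _ h => ?_
  -- None of these reloads targets the stack pointer, so `hsp` still computes every address.
  iterate 8
    refine h.restore (hi rfl) (congrArg (· + _) hsp) rfl (by omega) fun _ m h => ?_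
  refine h.restoreRetAddr (hi rfl) (congrArg (· + _) hsp) (by rw [hslot]) fun m h => ?_
  refine h.opImm (hi rfl) fun _ m _ h => ?_
  exact h.ret (hi rfl) rfl hret

end Bedrock2

namespace RiscV

/-! ### Memory layout at the call -/

/-- The length bound in `bytesAt` ensures that subtracting the base address recovers the index
without wrap-around. -/
theorem bytesAt_isSome {a : Word} {bs : List Byte} {m : Mem} (h : bytesAt a bs m) {i : ℕ}
    (hi : i < bs.length) : (m (a + BitVec.ofNat 32 i)).isSome := by
  rw [h.2, BitVec.add_comm, BitVec.add_sub_cancel, BitVec.toNat_ofNat,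
    Nat.mod_eq_of_lt (hi.trans_le h.1)]
  simp [hi]

/-- The last `k` bytes of a byte array that ends just below `top`. -/
theorem bytesAt_isSome_top {top : Word} {bs : List Byte} {m : Mem}
    (h : bytesAt (top - BitVec.ofNat 32 bs.length) bs m) {k i : ℕ} (hk : k ≤ bs.length)
    (hi : i < k) : (m (top - BitVec.ofNat 32 k + BitVec.ofNat 32 i)).isSome := by
  have hlen : BitVec.ofNat 32 bs.length = BitVec.ofNat 32 (bs.length - k) + BitVec.ofNat 32 k := by
    rw [← BitVec.ofNat_add, Nat.sub_add_cancel hk]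
  have haddr : top - BitVec.ofNat 32 k + BitVec.ofNat 32 i =
      top - BitVec.ofNat 32 bs.length + BitVec.ofNat 32 (bs.length - k + i) := by
    rw [BitVec.ofNat_add, hlen]
    abel
  rw [haddr]
  exact bytesAt_isSome h (by omega)

theorem codeAt_getElem? {pos : Word} {code : List Instr} {m : Mem} (h : codeAt pos code m)
    {k j : ℕ} {i : Instr} (hi : code[k]? = some i) (hj : j < 4) :
    m (pos + BitVec.ofNat 32 (4 * k + j)) = some ((encode i).extractLsb' (8 * j) 8) := by
  have hget := flatMap_wordBytes_getElem? encode code hi hj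
  have hlt := (List.getElem?_eq_some_iff.1 hget).1
  rw [h.2, BitVec.add_comm, BitVec.add_sub_cancel, BitVec.toNat_ofNat,
    Nat.mod_eq_of_lt (hlt.trans_le h.1), hget]

theorem codeAt_isSome {pos : Word} {code : List Instr} {m : Mem} (h : codeAt pos code m) {j : ℕ}
    (hj : j < 4 * code.length) : (m (pos + BitVec.ofNat 32 j)).isSome := by
  have hk : j / 4 < code.length := by omega
  have := codeAt_getElem? h (List.getElem?_eq_getElem hk) (Nat.mod_lt j (by norm_num))
  rw [Nat.div_add_mod] at this
  simp [this]

end RiscV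

/-! ### Instantiation at the initial machine state -/

open RiscV Bedrock2 in
theorem mainTheorem11 :
    ∃ out : Output,
      compile noExt [memequal] = some out ∧ out.funPos.lookup memequalName = some 0 ∧
      ∀ x y n pos stackPointer retAddr : Word,
        ∃ finalK : List LeakageEvent,
          ∀ (xs ys stackSpace : List Byte) (Rx Ry : Mem → Prop) (initial : Machine),
            xs.length = n.toNat → ys.length = n.toNat →
            4 * out.stackWords ≤ stackSpace.length →
            sep (codeAt pos out.code)
              (sep (bytesAt (stackPointer - BitVec.ofNat 32 stackSpace.length) stackSpace)
                (fun data => sep (bytesAt x xs) Rx data ∧ sep (bytesAt y ys) Ry data))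
              initial.mem →
            (∀ i < 4 * out.code.length, initial.xaddrs (pos + BitVec.ofNat 32 i) = true) →
            pos.toNat % 4 = 0 → retAddr.toNat % 4 = 0 →
            initial.pc = pos → initial.leakage = [] →
            initial.regs sp = stackPointer → initial.regs ra = retAddr →
            argRegsContain initial.regs [x, y, n] →
            RunsTo initial (fun final => final.pc = retAddr ∧ final.leakage = finalK) := by
  refine ⟨_, compile_memequal, rfl, fun x y n pos stackPointer retAddr => ?_⟩
  -- 36 bytes are the 9 stack words; the prologue lowers the stack pointer by this amount.
  let frame : Word := stackPointer - BitVec.ofNat 32 36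
  let trace := prologueTrace frame ++ (loopTrace n.toNat x y ++ epilogueTrace frame retAddr)
  -- The witness is fixed before the byte lists and the machine are introduced; this order of
  -- quantifiers is the constant-time claim.
  refine ⟨events pos trace, ?_⟩
  intro xs ys stackSpace Rx Ry initial hxs hys hstack hmem hexec hpos hret hpc hleak hsp hra hargs
  obtain ⟨mc, mr, hdisj, hmem, hcode, ms, md, -, hmr, hst, ⟨mx, mx', -, hmx, hx, -⟩,
    ⟨my, my', -, hmy, hy, -⟩⟩ := hmem
  dsimp only at hstack hexec hcode
  have hrest {a : Word} (h : (mr a).isSome) : (initial.mem a).isSome := by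
    have hc : mc a = none := (hdisj a).resolve_right (Option.isSome_iff_ne_none.1 h)
    simpa [hmem, hc] using h
  have hdata {a : Word} (h : (md a).isSome) : (initial.mem a).isSome := by
    apply hrest
    rw [hmr]
    cases ms a <;> simp [h]
  have hframe : ∀ i < 36, (mr (frame + BitVec.ofNat 32 i)).isSome := fun i hi => by
    have := bytesAt_isSome_top hst hstack hi
    rw [hmr]
    obtain ⟨b, hb⟩ := Option.isSome_iff_exists.1 this
    simp [frame, hb]
  -- Everything mapped at the start counts as `mapped`, which covers the frame and both arrays at
  -- once, even if the arrays overlap.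
  let A : Activation :=
    { code := memequalCode
      pos, frame, retAddr
      slot := 32
      mapped := {a | (initial.mem a).isSome}
      finalK := events pos trace
      decodes := decode_encode_memequalCode
      aligned := hpos
      slot_lt := by norm_num
      frame_disjoint := fun i hi j hj heq => by
        have hc := codeAt_isSome hcode hj
        have hf := hframe i hi
        rw [heq] at hf
        rcases hdisj (pos + BitVec.ofNat 32 j) with h | h
        · simp [h] at hc
        · simp [h] at hf
      frame_mapped := fun i hi => hrest (hframe i hi) }
  have hrun : A.Running False 0 initial.regs trace initial :=
    { pc := by simp [hpc, A]
      regs := rfl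
      leakage := by simp [hleak, A]
      code := fun k i hi j hj => by simp [A, hmem, codeAt_getElem? hcode hi hj]
      executable := hexec
      mapped := fun a ha => ha
      slot := False.elim }
  have hsp' : initial.regs 2 = A.frame + 36 := by
    rw [show initial.regs 2 = stackPointer from hsp]
    exact (BitVec.sub_add_cancel _ _).symm
  refine runsTo_prologue rfl rfl hrun hsp' hra (hargs.2 0 x rfl) (hargs.2 1 y rfl)
    (hargs.2 2 n rfl) fun R m h h2 h6 h7 h8 => ?_
  refine runsTo_loop (A := A) rfl n.toNat n.isLt x y (fun i hi => hdata ?_) (fun i hi => hdata ?_) h h2 h6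
    h7 (h8.trans (by simp)) fun R m h h2 => runsTo_epilogue rfl rfl h h2 hret
  · obtain ⟨b, hb⟩ := Option.isSome_iff_exists.1 (bytesAt_isSome hx (hxs.symm ▸ hi))
    simp [hmx, hb]
  · obtain ⟨b, hb⟩ := Option.isSome_iff_exists.1 (bytesAt_isSome hy (hys.symm ▸ hi))
    simp [hmy, hb]
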